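/- Let $p$ be a prime. A $p$-valuation on a group $H$ is a function $\omega\colon H\to(0,\infty]$ such that, for all $g,h\in H$: $\omega(g)=\infty$ if and only if $g=1$; $\omega(g)>\frac{1}{p-1}$; $\omega(g^{-1}h)\ge\min\{\omega(g),\omega(h)\}$; $\omega(ghg^{-1}h^{-1})\ge\omega(g)+\omega(h)$; and $\omega(g^p)=\omega(g)+1$. Let $(H,\omega)$ be a $p$-valued group, i.e. a topological group $H$ with a $p$-valuation $\omega$ that defines its topology (the sets $\{\omega\ge\nu\}$, $\nu<\infty$, form a neighbourhood basis of $1$). Suppose that $(H,\omega)$ is saturated, i.e. every $g\in H$ with $\omega(g)>\frac{p}{p-1}$ is a $p$-th power in $H$. Let $(h_1,\ldots,h_d)$ be an ordered basis of $(H,\omega)$, i.e. the map $(x_1,\ldots,x_d)\mapsto h_1^{x_1}\cdots h_d^{x_d}$ is a homeomorphism $\mathbb{Z}_p^d\to H$ and $\omega(h_1^{x_1}\cdots h_d^{x_d})=\min_{1\le i\le d}\{v(x_i)+\omega(h_i)\}$ for all $x\in\mathbb{Z}_p^d$; here $g^x=\lim g^m$ as the integer $m$ tends to $x$ in $\mathbb{Z}_p$,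 $v$ is the $p$-adic valuation with $v(p)=1$ and $v(0)=\infty$, and an empty minimum is $\infty$. Let $\mathbb{Q}_p\langle Z_1,\ldots,Z_d\rangle$ be the Tate algebra of power series over $\mathbb{Q}_p$ whose coefficients tend to $0$. Then there exists a unique rigid analytic group $\mathbb{H}$ over $\mathbb{Q}_p$ (that is, a unique group object structure on the rigid analytic space in (a)) such that (a) $\mathbb{H}=\mathrm{Sp}(\mathbb{Q}_p\langle Z_1,\ldots,Z_d\rangle)$, the $d$-dimensional closed ball, as a rigid analytic space; (b) the map $\varphi\mapsto h_1^{\varphi(Z_1)}\cdots h_d^{\varphi(Z_d)}$ (note that $\varphi(Z_i)\in\mathbb{Z}_p$) is an isomorphism of abstract groups $$\mathbb{H}(\mathbb{Q}_p)=\mathrm{Hom}_{\mathbb{Q}_p\text{-alg}}(\mathbb{Q}_p\langle Z_1,\ldots,Z_d\rangle,\mathbb{Q}_p)\overset{\sim}{\longrightarrow}H.$$ -/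

import Mathlib

open Filter Topology
open scoped ENNReal

/-! ### The Tate algebra -/

/-- The Tate algebra `ℚ_p⟨Z_i : i ∈ σ⟩` of power series `∑ c_I Z^I` whose coefficients `c_I` tend
to zero (along the cofinite filter on multi-indices). -/
noncomputable def tateSubalgebra (p : ℕ) [Fact p.Prime] (σ : Type) :
    Subalgebra ℚ_[p] (MvPowerSeries σ ℚ_[p]) :=
  { MvPowerSeries.IsRestricted.subring (R := ℚ_[p]) (fun _ : σ => (1 : ℝ)) with
    algebraMap_mem' := fun r => MvPowerSeries.isRestricted_C _ r }

def TateAlgebra (p : ℕ) [Fact p.Prime] (σ : Type) : Type := tateSubalgebra p σ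

namespace TateAlgebra

variable {p : ℕ} [Fact p.Prime] {σ : Type}

noncomputable instance : CommRing (TateAlgebra p σ) :=
  inferInstanceAs (CommRing (tateSubalgebra p σ))

noncomputable instance : Algebra ℚ_[p] (TateAlgebra p σ) :=
  inferInstanceAs (Algebra ℚ_[p] (tateSubalgebra p σ))

/-- The coefficient `c_I` of `∑ c_I Z^I`. -/
noncomputable def coeff (I : σ →₀ ℕ) : TateAlgebra p σ →ₗ[ℚ_[p]] ℚ_[p] :=
  (MvPowerSeries.coeff I).comp (tateSubalgebra p σ).val.toLinearMap

theorem tendsto_coeff (f : TateAlgebra p σ) :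
    Tendsto (fun I => ‖coeff I f‖) cofinite (𝓝 0) := by
  have h : MvPowerSeries.IsRestricted (fun _ : σ => (1 : ℝ)) f.1 := f.2
  simp only [MvPowerSeries.IsRestricted, Finsupp.prod, one_pow, Finset.prod_const_one,
    mul_one] at h
  exact h

theorem ext_coeff {f g : TateAlgebra p σ} (h : ∀ I, coeff I f = coeff I g) : f = g :=
  Subtype.ext (MvPowerSeries.ext h)

theorem coeff_one [DecidableEq σ] (I : σ →₀ ℕ) :
    coeff I (1 : TateAlgebra p σ) = if I = 0 then 1 else 0 :=
  MvPowerSeries.coeff_one (R := ℚ_[p]) I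

theorem coeff_mul [DecidableEq σ] (I : σ →₀ ℕ) (f g : TateAlgebra p σ) :
    coeff I (f * g) = ∑ q ∈ Finset.HasAntidiagonal.antidiagonal I, coeff q.1 f * coeff q.2 g :=
  MvPowerSeries.coeff_mul (R := ℚ_[p]) I f.1 g.1

/-- The power series with a given null family of coefficients. -/
noncomputable def ofCoeff (c : (σ →₀ ℕ) → ℚ_[p])
    (hc : Tendsto (fun I => ‖c I‖) cofinite (𝓝 0)) : TateAlgebra p σ :=
  ⟨(c : MvPowerSeries σ ℚ_[p]), show MvPowerSeries.IsRestricted (fun _ : σ => (1 : ℝ)) _ by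
    simp only [MvPowerSeries.IsRestricted, Finsupp.prod, one_pow, Finset.prod_const_one, mul_one]
    exact hc⟩

theorem coeff_ofCoeff (c : (σ →₀ ℕ) → ℚ_[p]) (hc) (I : σ →₀ ℕ) :
    coeff I (ofCoeff c hc) = c I := rfl

/-- The variable `Z_i`. -/
noncomputable def X (i : σ) : TateAlgebra p σ :=
  ⟨MvPowerSeries.X i, MvPowerSeries.isRestricted_monomial _ _ _⟩

theorem coeff_X [DecidableEq σ] (I : σ →₀ ℕ) (i : σ) :
    coeff I (X i : TateAlgebra p σ) = if I = Finsupp.single i 1 then 1 else 0 :=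
  MvPowerSeries.coeff_X (R := ℚ_[p]) I i

theorem bddAbove_coeff (f : TateAlgebra p σ) :
    BddAbove (Set.range fun I => ‖coeff I f‖) := by
  have h := (tendsto_coeff f).eventually (gt_mem_nhds one_pos)
  rw [eventually_cofinite] at h
  refine ((h.image fun I => ‖coeff I f‖).bddAbove.union (bddAbove_Iic (a := (1 : ℝ)))).mono ?_
  rintro _ ⟨I, rfl⟩
  by_cases hI : ‖coeff I f‖ < 1
  · exact Or.inr hI.le
  · exact Or.inl ⟨I, hI, rfl⟩

/-- The Gauss norm `‖∑ c_I Z^I‖ = sup_I |c_I|`. -/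
noncomputable instance : Norm (TateAlgebra p σ) := ⟨fun f => ⨆ I, ‖coeff I f‖⟩

theorem norm_def (f : TateAlgebra p σ) : ‖f‖ = ⨆ I, ‖coeff I f‖ := rfl

theorem norm_coeff_le (f : TateAlgebra p σ) (I : σ →₀ ℕ) : ‖coeff I f‖ ≤ ‖f‖ :=
  le_ciSup (bddAbove_coeff f) I

theorem norm_le_of {f : TateAlgebra p σ} {C : ℝ} (h : ∀ I, ‖coeff I f‖ ≤ C) : ‖f‖ ≤ C :=
  ciSup_le h

theorem gauss_nonneg (f : TateAlgebra p σ) : 0 ≤ ‖f‖ :=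
  (norm_nonneg _).trans (norm_coeff_le f 0)

theorem gauss_add_le_max (f g : TateAlgebra p σ) : ‖f + g‖ ≤ max ‖f‖ ‖g‖ :=
  norm_le_of fun I => by
    rw [map_add]
    exact (IsUltrametricDist.norm_add_le_max _ _).trans
      (max_le_max (norm_coeff_le f I) (norm_coeff_le g I))

/-- The Gauss norm as a ring norm. -/
noncomputable def gaussRingNorm (p : ℕ) [Fact p.Prime] (σ : Type) :
    RingNorm (TateAlgebra p σ) where
  toFun f := ‖f‖
  map_zero' := le_antisymm (norm_le_of fun I => by simp) (gauss_nonneg 0)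
  add_le' f g := (gauss_add_le_max f g).trans
    (max_le_add_of_nonneg (gauss_nonneg f) (gauss_nonneg g))
  neg' f := by simp [norm_def]
  mul_le' f g := norm_le_of fun I => by
    classical
    rw [coeff_mul]
    refine IsUltrametricDist.norm_sum_le_of_forall_le_of_nonneg
      (mul_nonneg (gauss_nonneg f) (gauss_nonneg g)) fun q _ => ?_
    rw [norm_mul]
    exact mul_le_mul (norm_coeff_le f _) (norm_coeff_le g _) (norm_nonneg _) (gauss_nonneg f)
  eq_zero_of_map_eq_zero' f hf := ext_coeff fun I => by
    have h : ‖f‖ = 0 := hf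
    simpa using (norm_coeff_le f I).trans h.le

noncomputable instance : NormedCommRing (TateAlgebra p σ) :=
  { (gaussRingNorm p σ).toNormedRing, (inferInstance : CommRing (TateAlgebra p σ)) with
    norm := fun f => ⨆ I, ‖coeff I f‖ }

noncomputable instance : NormedAlgebra ℚ_[p] (TateAlgebra p σ) where
  norm_smul_le r f := norm_le_of fun I => by
    rw [map_smul, norm_smul]
    exact mul_le_mul_of_nonneg_left (norm_coeff_le f I) (norm_nonneg r)

instance : IsUltrametricDist (TateAlgebra p σ) :=
  IsUltrametricDist.isUltrametricDist_of_forall_norm_add_le_max_norm gauss_add_le_max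

theorem norm_X_le (i : σ) : ‖(X i : TateAlgebra p σ)‖ ≤ 1 :=
  norm_le_of fun I => by
    classical
    rw [coeff_X]
    split_ifs <;> simp

instance : NormOneClass (TateAlgebra p σ) where
  norm_one := by
    classical
    refine le_antisymm (norm_le_of fun I => ?_) ?_
    · rw [coeff_one]
      split_ifs <;> simp
    · simpa [coeff_one] using norm_coeff_le (1 : TateAlgebra p σ) 0

instance : CompleteSpace (TateAlgebra p σ) := by
  refine Metric.complete_of_cauchySeq_tendsto fun u hu => ?_
  have hc : ∀ I, CauchySeq fun n => coeff I (u n) := fun I => by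
    refine Metric.cauchySeq_iff'.2 fun ε hε => ?_
    obtain ⟨N, hN⟩ := Metric.cauchySeq_iff'.1 hu ε hε
    refine ⟨N, fun n hn => lt_of_le_of_lt ?_ (hN n hn)⟩
    rw [dist_eq_norm, dist_eq_norm, ← map_sub]
    exact norm_coeff_le _ I
  choose c hcl using fun I => cauchySeq_tendsto_of_complete (hc I)
  have key : ∀ ε > 0, ∃ N, ∀ n ≥ N, ∀ I, ‖coeff I (u n) - c I‖ ≤ ε := fun ε hε => by
    obtain ⟨N, hN⟩ := Metric.cauchySeq_iff.1 hu ε hε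
    refine ⟨N, fun n hn I => ?_⟩
    refine le_of_tendsto ((tendsto_const_nhds.sub (hcl I)).norm) ?_
    filter_upwards [eventually_ge_atTop N] with m hm
    rw [← map_sub]
    refine (norm_coeff_le _ I).trans ?_
    rw [← dist_eq_norm]
    exact (hN n hn m hm).le
  have hnull : Tendsto (fun I => ‖c I‖) cofinite (𝓝 0) := by
    rw [Metric.tendsto_nhds]
    intro ε hε
    obtain ⟨N, hN⟩ := key (ε / 2) (half_pos hε)
    filter_upwards [(tendsto_coeff (u N)).eventually (gt_mem_nhds (half_pos hε))] with I hI
    rw [dist_zero_right, norm_norm]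
    calc ‖c I‖ = ‖coeff I (u N) - (coeff I (u N) - c I)‖ := by rw [sub_sub_cancel]
      _ ≤ ‖coeff I (u N)‖ + ‖coeff I (u N) - c I‖ := norm_sub_le _ _
      _ < ε := by linarith [hN N le_rfl I]
  refine ⟨ofCoeff c hnull, Metric.tendsto_atTop.2 fun ε hε => ?_⟩
  obtain ⟨N, hN⟩ := key (ε / 2) (half_pos hε)
  refine ⟨N, fun n hn => lt_of_le_of_lt ?_ (half_lt_self hε)⟩
  rw [dist_eq_norm]
  refine norm_le_of fun I => ?_
  rw [map_sub, coeff_ofCoeff]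
  exact hN n hn I

end TateAlgebra

/-! ### Affinoid algebras and rigid analytic groups -/

/-- Affinoid `ℚ_p`-algebras, as Banach algebras: complete, with an ultrametric norm, and admitting
a continuous epimorphism from some Tate algebra `ℚ_p⟨Z_1, …, Z_n⟩`. -/
class IsAffinoidAlgebra (p : ℕ) [Fact p.Prime] (A : Type) [NormedCommRing A]
    [NormedAlgebra ℚ_[p] A] : Prop where
  complete : CompleteSpace A
  ultrametric : IsUltrametricDist A
  exists_presentation :
    ∃ (n : ℕ) (π : TateAlgebra p (Fin n) →A[ℚ_[p]] A), Function.Surjective π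

instance (p : ℕ) [Fact p.Prime] (n : ℕ) : IsAffinoidAlgebra p (TateAlgebra p (Fin n)) where
  complete := inferInstance
  ultrametric := inferInstance
  exists_presentation := ⟨n, ContinuousAlgHom.id _ _, Function.surjective_id⟩

instance (p : ℕ) [Fact p.Prime] : IsAffinoidAlgebra p ℚ_[p] where
  complete := inferInstance
  ultrametric := inferInstance
  exists_presentation := by
    let π : TateAlgebra p (Fin 0) →ₐ[ℚ_[p]] ℚ_[p] :=
      AlgHom.ofLinearMap (TateAlgebra.coeff 0) (by simp [TateAlgebra.coeff_one])
        (by simp [TateAlgebra.coeff_mul])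
    exact ⟨0, ⟨π, map_continuous π⟩, fun r => ⟨algebraMap _ _ r, π.commutes r⟩⟩

/-- A rigid analytic group structure on the affinoid space `Sp B`, i.e. a structure of group object
on `Sp B`. A morphism of affinoid spaces `Sp A ⟶ Sp B` is a continuous `ℚ_p`-algebra homomorphism
`B → A` (continuity is automatic for homomorphisms of affinoid algebras), and a group object is
given through its functor of points: a group structure on the set `Hom(Sp A, Sp B)` for every
affinoid `A` such that `Hom(Sp A, Sp B) → Hom(Sp A', Sp B)` is a group homomorphism for every
morphism `Sp A' ⟶ Sp A`. -/
structure RigidGroupStructure (p : ℕ) [Fact p.Prime] (B : Type) [NormedCommRing B]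
    [NormedAlgebra ℚ_[p] B] where
  group : ∀ (A : Type) [NormedCommRing A] [NormedAlgebra ℚ_[p] A] [IsAffinoidAlgebra p A],
    Group (B →A[ℚ_[p]] A)
  comp_mul : ∀ (A A' : Type) [NormedCommRing A] [NormedAlgebra ℚ_[p] A] [IsAffinoidAlgebra p A]
    [NormedCommRing A'] [NormedAlgebra ℚ_[p] A'] [IsAffinoidAlgebra p A']
    (f : A →A[ℚ_[p]] A') (x y : B →A[ℚ_[p]] A),
    f.comp ((group A).mul x y) = (group A').mul (f.comp x) (f.comp y)

/-- Every `ℚ_p`-algebra homomorphism from a Banach algebra to `ℚ_p` is continuous. -/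
noncomputable def algHomEquivContinuousAlgHom (p : ℕ) [Fact p.Prime] (B : Type) [NormedCommRing B]
    [NormedAlgebra ℚ_[p] B] [CompleteSpace B] :
    (B →ₐ[ℚ_[p]] ℚ_[p]) ≃ (B →A[ℚ_[p]] ℚ_[p]) where
  toFun φ := ⟨φ, map_continuous φ⟩
  invFun φ := φ.toAlgHom
  left_inv _ := rfl
  right_inv _ := rfl

namespace RigidGroupStructure

variable {p : ℕ} [Fact p.Prime] {B : Type} [NormedCommRing B] [NormedAlgebra ℚ_[p] B]

/-- The group of `ℚ_p`-points `Hom_{ℚ_p-alg}(B, ℚ_p)` of the rigid analytic group. -/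
def Points (_G : RigidGroupStructure p B) : Type := B →ₐ[ℚ_[p]] ℚ_[p]

noncomputable instance [CompleteSpace B] (G : RigidGroupStructure p B) : Group G.Points :=
  letI := G.group ℚ_[p]
  Equiv.group (algHomEquivContinuousAlgHom p B)

/-- A `ℚ_p`-algebra homomorphism `B → ℚ_p`, regarded as a `ℚ_p`-point. -/
def toPoints (G : RigidGroupStructure p B) : (B →ₐ[ℚ_[p]] ℚ_[p]) ≃ G.Points := Equiv.refl _

end RigidGroupStructure

/-- The coordinate `φ(Z_i)` of a `ℚ_p`-point of the closed ball, as a `p`-adic integer. -/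
noncomputable def TateAlgebra.pointCoord {p : ℕ} [Fact p.Prime] {σ : Type}
    (φ : TateAlgebra p σ →ₐ[ℚ_[p]] ℚ_[p]) (i : σ) : ℤ_[p] :=
  ⟨φ (TateAlgebra.X i), (AlgHom.norm_apply_le_self φ _).trans (TateAlgebra.norm_X_le i)⟩

/-! ### `p`-valued groups -/

/-- A `p`-valuation on a group, extended by `ω(1) = ∞`. -/
structure PValuation (p : ℕ) (H : Type*) [Group H] where
  toFun : H → ℝ≥0∞
  eq_top_iff : ∀ g, toFun g = ⊤ ↔ g = 1
  one_div_lt : ∀ g, 1 / ((p : ℝ≥0∞) - 1) < toFun g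
  min_le_inv_mul : ∀ g h, min (toFun g) (toFun h) ≤ toFun (g⁻¹ * h)
  add_le_commutator : ∀ g h, toFun g + toFun h ≤ toFun (g * h * g⁻¹ * h⁻¹)
  pow_p : ∀ g, toFun (g ^ p) = toFun g + 1

/-- The `p`-adic power `g ^ x`: the limit of `g ^ m` as the integer `m` tends `p`-adically to
`x`. -/
noncomputable def padicPow {p : ℕ} [Fact p.Prime] {H : Type*} [Group H] [TopologicalSpace H]
    (g : H) (x : ℤ_[p]) : H :=
  haveI : Nonempty H := ⟨1⟩
  limUnder (comap (fun m : ℤ => (m : ℤ_[p])) (𝓝 x)) (fun m : ℤ => g ^ m)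

/-- The ordered product `h_1 ^ x_1 ⋯ h_d ^ x_d`. -/
noncomputable def orderedProd {p : ℕ} [Fact p.Prime] {H : Type*} [Group H] [TopologicalSpace H]
    {d : ℕ} (h : Fin d → H) (x : Fin d → ℤ_[p]) : H :=
  (List.ofFn fun i => padicPow (h i) (x i)).prod

namespace PValuation

variable {p : ℕ} {H : Type*} [Group H]

instance : CoeFun (PValuation p H) (fun _ => H → ℝ≥0∞) := ⟨PValuation.toFun⟩

/-- The topology of `H` is the one defined by `ω`: the sets `{ω ≥ ν}`, `ν < ∞`, form a basis of
neighbourhoods of `1`. -/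
def DefinesTopology [TopologicalSpace H] (ω : PValuation p H) : Prop :=
  (𝓝 (1 : H)).HasBasis (fun ν : ℝ≥0∞ => ν < ⊤) (fun ν => {g | ν ≤ ω g})

/-- `(H, ω)` is saturated: every `g` with `ω(g) > p / (p - 1)` is a `p`-th power. -/
def IsSaturated (ω : PValuation p H) : Prop :=
  ∀ g, (p : ℝ≥0∞) / ((p : ℝ≥0∞) - 1) < ω g → ∃ h, h ^ p = g

/-- `(h_1, …, h_d)` is an ordered basis of `(H, ω)`: the map `x ↦ h_1 ^ x_1 ⋯ h_d ^ x_d` is a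
homeomorphism `ℤ_p^d → H`, and `ω(h_1 ^ x_1 ⋯ h_d ^ x_d) = min_i (v(x_i) + ω(h_i))`. -/
structure IsOrderedBasis [Fact p.Prime] [TopologicalSpace H] (ω : PValuation p H) {d : ℕ}
    (h : Fin d → H) : Prop where
  isHomeomorph : IsHomeomorph (fun x : Fin d → ℤ_[p] => orderedProd h x)
  apply_orderedProd : ∀ x : Fin d → ℤ_[p],
    ω (orderedProd h x) = ⨅ i, ((emultiplicity (p : ℤ_[p]) (x i) : ℕ∞) : ℝ≥0∞) + ω (h i)

end PValuation

/-!
The group law of a saturated `p`-valued group is given in the coordinates of an ordered basis by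
power series in the Tate algebra of Gauss norm at most one; the rigid analytic group is then forced
by the identity principle.

*Analyticity.* Write `ψ_i` for the additive extension to the group ring `ℤ[H]` of the `i`-th
coordinate function of `H`, and filter `ℤ[H]` by the smallest multiplicative filtration in which `p`
has weight `1` and `g - 1` has weight `ω(g)`. For `g_1, …, g_m ∈ H`, expanding
`g_j^{n_j} = (1 + (g_j - 1))^{n_j}` shows that the `i`-th coordinate of `g_1^{n_1} ⋯ g_m^{n_m}` is
`∑_γ c_γ ∏_j binom(n_j, γ_j)`, where `c_γ` is the value of `ψ_i` at the ordered monomial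
`∏_j (g_j - 1)^{γ_j}`, of weight `∑_j γ_j ω(g_j)`. The key fact is `le_emultiplicity_add`: `ψ_i`
maps elements of weight `ν` to elements of valuation at least `ν - ω(h_i)`. Since
`ω(g_j) > 1 / (p - 1)`, since `v(γ!) ≤ (|γ| - 1) / (p - 1)`, and since `ω(h_i) ≤ p / (p - 1)` by
saturation (`apply_basis_le`), the numbers `c_γ / γ!` tend to zero and have valuation greater
than `-1`, so they are integral. This is `exists_tateAlgebra_point_eq_coord`, which applies to the
multiplication and to the inversion.

*The key fact.* By a rewriting argument of Poincaré–Birkhoff–Witt type (`filtration_le_sup`), every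
element of weight `ν` is a combination of the monomials `p^k ∏_j (h_j - 1)^{γ_j}` of weight at least
`ν`, up to an element of weight `ν + ε`, with `ε > 0` independent of `ν`: interchanging two factors
`h_i - 1` and `h_j - 1` costs `[h_j, h_i] - 1`, which by the commutator condition is of weight at
least `ω(h_i) + ω(h_j)` and is, to leading order, linear in the `h_l - 1`. The error term can thus
be moved to arbitrarily large weight, where `ψ_i` is divisible by any given power of `p`, because
modulo `p^K` it factors through a finite quotient of `H`, a `p`-group, whose augmentation ideal is
nilpotent modulo `p^K` (`exists_forall_dvd_linearExtension`). On the ordered monomials in the basis,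
`ψ_i` is the indicator of `h_i - 1`.

*The rigid group.* Points of the closed ball with values in an affinoid algebra `A` are tuples of
power-bounded elements of `A`, and a series over `ℚ_p` vanishing on `ℤ_p^σ` is zero
(`eq_zero_of_forall_point_eq_zero`). Hence an identity between morphisms of closed balls may be
checked on `ℚ_p`-points. This proves the group axioms, which need only be checked for universal
points, and uniqueness, since a natural group law is determined by the product of the two
projections from the product of two balls.
-/

/-! ### Morphisms out of the Tate algebra -/

namespace TateAlgebra

variable {p : ℕ} [Fact p.Prime] {σ : Type}

/-- The inclusion of the Tate algebra into all formal power series. -/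
noncomputable def toPowerSeries (p : ℕ) [Fact p.Prime] (σ : Type) :
    TateAlgebra p σ →ₐ[ℚ_[p]] MvPowerSeries σ ℚ_[p] :=
  (tateSubalgebra p σ).val

theorem coeff_toPowerSeries (I : σ →₀ ℕ) (f : TateAlgebra p σ) :
    MvPowerSeries.coeff I (toPowerSeries p σ f) = coeff I f := rfl

/-- The coefficient map as a continuous linear map. -/
noncomputable def coeffL (I : σ →₀ ℕ) : TateAlgebra p σ →L[ℚ_[p]] ℚ_[p] :=
  LinearMap.mkContinuous (coeff I) 1 fun f => by simpa using norm_coeff_le f I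

theorem coeffL_apply (I : σ →₀ ℕ) (f : TateAlgebra p σ) : coeffL I f = coeff I f := rfl

theorem summable_coeff_smul {A : Type*} [NormedCommRing A] [NormedAlgebra ℚ_[p] A]
    [CompleteSpace A] [IsUltrametricDist A] {m : (σ →₀ ℕ) → A} {C : ℝ} (hm : ∀ I, ‖m I‖ ≤ C)
    (f : TateAlgebra p σ) : Summable fun I => coeff I f • m I := by
  refine NonarchimedeanAddGroup.summable_of_tendsto_cofinite_zero ?_
  refine squeeze_zero_norm (a := fun I => ‖coeff I f‖ * C) (fun I => ?_) ?_
  · exact (norm_smul_le _ _).trans (mul_le_mul_of_nonneg_left (hm I) (norm_nonneg _))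
  · simpa using (tendsto_coeff f).mul_const C

/-- A continuous homomorphism maps the unit ball of the Tate algebra to power-bounded elements. -/
theorem exists_norm_map_pow_le {A : Type*} [NormedCommRing A] [NormedAlgebra ℚ_[p] A]
    (u : TateAlgebra p σ →A[ℚ_[p]] A) {f : TateAlgebra p σ} (hf : ‖f‖ ≤ 1) :
    ∃ C : ℝ, ∀ n : ℕ, ‖u f ^ n‖ ≤ C := by
  refine ⟨‖u.toContinuousLinearMap‖, fun n => ?_⟩
  rw [← map_pow]
  refine (u.toContinuousLinearMap.le_opNorm (f ^ n)).trans ?_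
  refine mul_le_of_le_one_right (norm_nonneg _) ((norm_pow_le f n).trans ?_)
  exact pow_le_one₀ (norm_nonneg _) hf

variable [Fintype σ]

theorem coeff_prod_X_pow [DecidableEq σ] (I J : σ →₀ ℕ) :
    coeff J (∏ i, (X i : TateAlgebra p σ) ^ I i) = if J = I then 1 else 0 := by
  rw [← coeff_toPowerSeries, map_prod]
  have : ∏ i, toPowerSeries p σ (X i ^ I i) = MvPowerSeries.monomial I 1 := by
    rw [MvPowerSeries.monomial_one_eq, Finsupp.prod_fintype _ _ (by simp)]
    exact Finset.prod_congr rfl fun i _ => by rw [map_pow]; rfl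
  rw [this, MvPowerSeries.coeff_monomial]

theorem norm_prod_X_pow_le (I : σ →₀ ℕ) : ‖∏ i, (X i : TateAlgebra p σ) ^ I i‖ ≤ 1 :=
  norm_le_of fun J => by
    classical
    rw [coeff_prod_X_pow]
    split_ifs <;> simp

theorem hasSum_coeff_smul_prod_X_pow (f : TateAlgebra p σ) :
    HasSum (fun I => coeff I f • ∏ i, (X i : TateAlgebra p σ) ^ I i) f := by
  classical
  have hs := summable_coeff_smul (fun I => norm_prod_X_pow_le (p := p) I) f
  convert hs.hasSum
  refine ext_coeff fun J => ?_
  have h := hs.hasSum.mapL (coeffL J)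
  rw [coeffL_apply] at h
  refine HasSum.unique ?_ h
  convert hasSum_ite_eq J (coeff J f) using 2 with I
  rw [map_smul, coeffL_apply, coeff_prod_X_pow]
  by_cases hIJ : I = J
  · simp [hIJ]
  · simp [hIJ, Ne.symm hIJ]

theorem continuousLinearMap_ext {E : Type*} [NormedAddCommGroup E] [NormedSpace ℚ_[p] E]
    {u v : TateAlgebra p σ →L[ℚ_[p]] E}
    (h : ∀ I : σ →₀ ℕ, u (∏ i, X i ^ I i) = v (∏ i, X i ^ I i)) : u = v := by
  ext f
  have hu := (hasSum_coeff_smul_prod_X_pow f).mapL u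
  have hv := (hasSum_coeff_smul_prod_X_pow f).mapL v
  simp only [map_smul, h] at hu hv
  exact hu.unique hv

theorem continuousAlgHom_ext {A : Type*} [NormedCommRing A] [NormedAlgebra ℚ_[p] A]
    {u v : TateAlgebra p σ →A[ℚ_[p]] A} (h : ∀ i, u (X i) = v (X i)) : u = v := by
  have : u.toContinuousLinearMap = v.toContinuousLinearMap :=
    continuousLinearMap_ext fun I => by simp [map_prod, h]
  ext f
  exact congrArg (fun w => w f) this

variable {A : Type*} [NormedCommRing A] [NormedAlgebra ℚ_[p] A] [CompleteSpace A]
  [IsUltrametricDist A]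

/-- Evaluation `∑ c_I Z^I ↦ ∑ c_I m_I` at a bounded family `(m_I)`, as a continuous linear map. -/
noncomputable def evalLinear (m : (σ →₀ ℕ) → A) (C : ℝ) (hm : ∀ I, ‖m I‖ ≤ C) :
    TateAlgebra p σ →L[ℚ_[p]] A :=
  LinearMap.mkContinuous
    { toFun f := ∑' I, coeff I f • m I
      map_add' f g := by
        simp only [map_add, add_smul]
        exact (summable_coeff_smul hm f).tsum_add (summable_coeff_smul hm g)
      map_smul' r f := by
        simp only [map_smul, smul_eq_mul, mul_smul, RingHom.id_apply]
        exact (summable_coeff_smul hm f).tsum_const_smul r } C fun f => by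
    have hC : 0 ≤ C := (norm_nonneg _).trans (hm 0)
    refine IsUltrametricDist.norm_tsum_le_of_forall_le_of_nonneg
      (mul_nonneg hC (gauss_nonneg f)) fun I => (norm_smul_le _ _).trans ?_
    rw [mul_comm C]
    exact mul_le_mul (norm_coeff_le f I) (hm I) (norm_nonneg _) (gauss_nonneg f)

theorem evalLinear_prod_X_pow (m : (σ →₀ ℕ) → A) (C : ℝ) (hm : ∀ I, ‖m I‖ ≤ C) (I : σ →₀ ℕ) :
    evalLinear (p := p) m C hm (∏ i, X i ^ I i) = m I := by
  classical
  change ∑' J, coeff J (∏ i, (X i : TateAlgebra p σ) ^ I i) • m J = m I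
  rw [tsum_eq_single I]
  · simp [coeff_prod_X_pow]
  · intro J hJ
    simp [coeff_prod_X_pow, hJ]

/-- The continuous homomorphism out of the Tate algebra sending `Z_i` to `a_i`, for a family `a`
whose monomials are bounded. -/
noncomputable def eval (a : σ → A) (ha : ∃ C : ℝ, ∀ I : σ →₀ ℕ, ‖∏ i, a i ^ I i‖ ≤ C) :
    TateAlgebra p σ →A[ℚ_[p]] A :=
  let L : TateAlgebra p σ →L[ℚ_[p]] A :=
    evalLinear (fun I => ∏ i, a i ^ I i) ha.choose ha.choose_spec
  have hL : ∀ I : σ →₀ ℕ, L (∏ i, X i ^ I i) = ∏ i, a i ^ I i := evalLinear_prod_X_pow _ _ _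
  { AlgHom.ofLinearMap L.toLinearMap (by simpa using hL 0) (by
      -- Both sides are continuous and bilinear, so it is enough to compare them on monomials.
      intro f g
      have h₁ : ∀ I : σ →₀ ℕ, ∀ g, L ((∏ i, X i ^ I i) * g) = L (∏ i, X i ^ I i) * L g := by
        intro I g
        have : L.comp (ContinuousLinearMap.mul ℚ_[p] _ (∏ i, X i ^ I i)) =
            (ContinuousLinearMap.mul ℚ_[p] A (L (∏ i, X i ^ I i))).comp L :=
          continuousLinearMap_ext fun J => by
            have h := hL (I + J)
            simp only [Finsupp.add_apply, pow_add, Finset.prod_mul_distrib] at h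
            simpa [hL] using h
        exact congrArg (fun w => w g) this
      have h₂ : L.comp ((ContinuousLinearMap.mul ℚ_[p] _).flip g) =
          ((ContinuousLinearMap.mul ℚ_[p] A).flip (L g)).comp L :=
        continuousLinearMap_ext fun I => by simpa [mul_comm] using h₁ I g
      exact congrArg (fun w => w f) h₂) with
    cont := L.continuous }

theorem prod_pow_single {R : Type*} [CommMonoid R] (b : σ → R) (i : σ) :
    ∏ j, b j ^ (Finsupp.single i 1 j) = b i := by
  classical
  rw [Finset.prod_eq_single i] <;> simp +contextual [eq_comm]

@[simp] theorem eval_X (a : σ → A) (ha : ∃ C : ℝ, ∀ I : σ →₀ ℕ, ‖∏ i, a i ^ I i‖ ≤ C) (i : σ) :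
    eval (p := p) a ha (X i) = a i := by
  classical
  have h := evalLinear_prod_X_pow (p := p) _ ha.choose ha.choose_spec (Finsupp.single i 1)
  rw [prod_pow_single, prod_pow_single] at h
  exact h

/-- Finitely many power-bounded elements have jointly bounded monomials. -/
theorem exists_norm_prod_pow_le {A : Type*} [NormedCommRing A] {a : σ → A}
    (ha : ∀ i, ∃ C : ℝ, ∀ n : ℕ, ‖a i ^ n‖ ≤ C) :
    ∃ C : ℝ, ∀ I : σ →₀ ℕ, ‖∏ i, a i ^ I i‖ ≤ C := by
  classical
  suffices ∀ s : Finset σ, ∃ C : ℝ, ∀ I : σ →₀ ℕ, ‖∏ i ∈ s, a i ^ I i‖ ≤ C from this _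
  intro s
  induction s using Finset.induction_on with
  | empty => exact ⟨‖(1 : A)‖, fun I => by simp⟩
  | insert i s hi ih =>
    obtain ⟨C, hC⟩ := ih
    obtain ⟨D, hD⟩ := ha i
    refine ⟨D * C, fun I => ?_⟩
    rw [Finset.prod_insert hi]
    exact (norm_mul_le _ _).trans
      (mul_le_mul (hD _) (hC I) (norm_nonneg _) ((norm_nonneg _).trans (hD 0)))

/-! ### The identity principle on `ℤ_p`-points -/

/-- The `ℚ_p`-point of the closed ball with coordinates `a ∈ ℤ_p^σ`. -/
noncomputable def point (a : σ → ℤ_[p]) : TateAlgebra p σ →A[ℚ_[p]] ℚ_[p] :=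
  eval (fun i => (a i : ℚ_[p])) (exists_norm_prod_pow_le fun i => ⟨1, fun n => by
    rw [norm_pow]
    exact pow_le_one₀ (norm_nonneg _) (a i).norm_le_one⟩)

@[simp] theorem point_X (a : σ → ℤ_[p]) (i : σ) : point a (X i) = a i := eval_X _ _ i

theorem hasSum_point (a : σ → ℤ_[p]) (f : TateAlgebra p σ) :
    HasSum (fun I => coeff I f * ∏ i, (a i : ℚ_[p]) ^ I i) (point a f) := by
  have h := (hasSum_coeff_smul_prod_X_pow f).mapL (point a).toContinuousLinearMap
  simpa [map_prod, map_pow] using h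

/-- The homogeneous part of lowest degree `n` of a series `f` vanishing on `ℤ_p^σ` vanishes on
`ℤ_p^σ`: it is the limit of `p^{-kn} f(p^k a)`. -/
theorem sum_coeff_mul_eq_zero_of_forall_point_eq_zero {f : TateAlgebra p σ}
    (hf : ∀ a, point a f = 0) {n : ℕ} (hn : ∀ I : σ →₀ ℕ, I.degree < n → coeff I f = 0)
    (a : σ → ℤ_[p]) :
    ∑ I ∈ (Finsupp.finite_of_degree_eq (σ := σ) n).toFinset,
      coeff I f * ∏ i, (a i : ℚ_[p]) ^ I i = 0 := by
  classical
  set S := (Finsupp.finite_of_degree_eq (σ := σ) n).toFinset with hS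
  have hp0 : (p : ℚ_[p]) ≠ 0 := by exact_mod_cast (Fact.out : p.Prime).ne_zero
  have hp1 : ‖(p : ℚ_[p])‖ < 1 := Padic.norm_p_lt_one
  set s := ∑ I ∈ S, coeff I f * ∏ i, (a i : ℚ_[p]) ^ I i with hs
  have key : ∀ k : ℕ, ‖s‖ ≤ ‖(p : ℚ_[p])‖ ^ k * ‖f‖ := by
    intro k
    have hu := hasSum_point (fun i => (p : ℤ_[p]) ^ k * a i) f
    rw [hf] at hu
    have hterm : ∀ I : σ →₀ ℕ, ∏ i, ((((p : ℤ_[p]) ^ k * a i : ℤ_[p])) : ℚ_[p]) ^ I i =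
        (p : ℚ_[p]) ^ (k * I.degree) * ∏ i, (a i : ℚ_[p]) ^ I i := by
      intro I
      simp only [PadicInt.coe_mul, PadicInt.coe_pow, PadicInt.coe_natCast, mul_pow,
        Finset.prod_mul_distrib, Finset.prod_pow_eq_pow_sum, ← pow_mul, Finsupp.degree_eq_sum,
        Finset.mul_sum]
    simp only [hterm] at hu
    have hfin : HasSum (fun I => if I ∈ S then
        coeff I f * ((p : ℚ_[p]) ^ (k * I.degree) * ∏ i, (a i : ℚ_[p]) ^ I i) else 0)
        ((p : ℚ_[p]) ^ (k * n) * s) := by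
      have h := hasSum_sum_of_ne_finset_zero (L := .unconditional (σ →₀ ℕ)) (s := S) (f := fun I =>
        if I ∈ S then coeff I f * ((p : ℚ_[p]) ^ (k * I.degree) * ∏ i, (a i : ℚ_[p]) ^ I i) else 0)
        (fun I hI => if_neg hI)
      convert h using 1
      rw [hs, Finset.mul_sum]
      refine Finset.sum_congr rfl fun I hI => ?_
      have : I.degree = n := by simpa [hS] using hI
      rw [if_pos hI, this]
      ring
    have hd := hu.sub hfin
    have hle : ‖(0 : ℚ_[p]) - (p : ℚ_[p]) ^ (k * n) * s‖ ≤
        ‖(p : ℚ_[p])‖ ^ (k * (n + 1)) * ‖f‖ := by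
      rw [← hd.tsum_eq]
      refine IsUltrametricDist.norm_tsum_le_of_forall_le_of_nonneg
        (mul_nonneg (by positivity) (gauss_nonneg f)) fun I => ?_
      have h0 : 0 ≤ ‖(p : ℚ_[p])‖ ^ (k * (n + 1)) * ‖f‖ :=
        mul_nonneg (by positivity) (gauss_nonneg f)
      by_cases hI : I ∈ S
      · simpa [hI] using h0
      · rw [if_neg hI, sub_zero]
        have hne : I.degree ≠ n := by simpa [hS] using hI
        rcases lt_or_gt_of_ne hne with h | h
        · simpa [hn I h] using h0
        · rw [norm_mul, norm_mul, norm_pow, mul_comm]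
          refine mul_le_mul ?_ (norm_coeff_le f I) (norm_nonneg _) (by positivity)
          refine (mul_le_of_le_one_right (by positivity) ?_).trans
            (pow_le_pow_of_le_one (norm_nonneg _) hp1.le (Nat.mul_le_mul_left k h))
          rw [norm_prod]
          refine Finset.prod_le_one (fun _ _ => norm_nonneg _) fun i _ => ?_
          rw [norm_pow]
          exact pow_le_one₀ (norm_nonneg _) (a i).norm_le_one
    rw [zero_sub, norm_neg, norm_mul, norm_pow, mul_add, pow_add, mul_one, mul_assoc] at hle
    exact le_of_mul_le_mul_left hle (pow_pos (norm_pos_iff.2 hp0) _)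
  have hlim : Tendsto (fun k : ℕ => ‖(p : ℚ_[p])‖ ^ k * ‖f‖) atTop (𝓝 0) := by
    simpa using (tendsto_pow_atTop_nhds_zero_of_lt_one (norm_nonneg _) hp1).mul_const ‖f‖
  exact norm_le_zero_iff.1 (ge_of_tendsto' hlim key)

/-- The identity principle: a series on the closed ball is determined by its values on `ℤ_p^σ`. -/
theorem eq_zero_of_forall_point_eq_zero {f : TateAlgebra p σ} (hf : ∀ a, point a f = 0) :
    f = 0 := by
  classical
  have key : ∀ n, ∀ I : σ →₀ ℕ, I.degree = n → coeff I f = 0 := by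
    intro n
    induction n using Nat.strong_induction_on with
    | _ n ih =>
      have hz := sum_coeff_mul_eq_zero_of_forall_point_eq_zero hf (n := n)
        (fun I hI => ih _ hI I rfl)
      set S := (Finsupp.finite_of_degree_eq (σ := σ) n).toFinset with hS
      have hP : ∑ I ∈ S, MvPolynomial.monomial I (coeff I f) = 0 := by
        refine MvPolynomial.funext_set (fun _ => Set.range ((↑) : ℤ_[p] → ℚ_[p]))
          (fun _ => Set.infinite_of_injective_forall_mem (f := fun n : ℕ => (n : ℚ_[p]))
            Nat.cast_injective fun n => ⟨(Nat.cast n : ℤ_[p]), PadicInt.coe_natCast n⟩)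
          fun x hx => ?_
        choose a ha using fun i => hx i (Set.mem_univ i)
        obtain rfl : (fun i => (a i : ℚ_[p])) = x := funext ha
        rw [map_sum, map_zero, ← hz a]
        refine Finset.sum_congr rfl fun I _ => ?_
        rw [MvPolynomial.eval_monomial, Finsupp.prod_fintype _ _ (by simp)]
      intro I hI
      have h := congrArg (MvPolynomial.coeff I) hP
      simpa [MvPolynomial.coeff_sum, MvPolynomial.coeff_monomial, hS, hI] using h
  exact ext_coeff fun I => by simpa using key _ I rfl

/-- Morphisms into `Sp ℚ_p⟨Z⟩` from a closed ball are determined by their effect on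
`ℚ_p`-points. -/
theorem continuousAlgHom_ext_of_points {B : Type*} [NormedCommRing B] [NormedAlgebra ℚ_[p] B]
    {u v : B →A[ℚ_[p]] TateAlgebra p σ}
    (h : ∀ q : TateAlgebra p σ →A[ℚ_[p]] ℚ_[p], q.comp u = q.comp v) : u = v := by
  ext b
  rw [← sub_eq_zero]
  refine eq_zero_of_forall_point_eq_zero fun a => ?_
  rw [map_sub, sub_eq_zero]
  exact congrArg (fun w => w b) (h (point a))

/-! ### Mahler series in the Tate algebra -/

/-- The polynomial `∏_j Z_j (Z_j - 1) ⋯ (Z_j - γ_j + 1)`. -/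
noncomputable def descFactorial (γ : σ → ℕ) : TateAlgebra p σ :=
  ∏ j, ∏ k ∈ Finset.range (γ j), (X j - (k : TateAlgebra p σ))

theorem norm_descFactorial_le (γ : σ → ℕ) : ‖(descFactorial γ : TateAlgebra p σ)‖ ≤ 1 := by
  have hprod : ∀ {ι : Type} (s : Finset ι) (f : ι → TateAlgebra p σ),
      (∀ i ∈ s, ‖f i‖ ≤ 1) → ‖∏ i ∈ s, f i‖ ≤ 1 := fun s f hf =>
    (Finset.norm_prod_le _ _).trans (Finset.prod_le_one (fun _ _ => norm_nonneg _) hf)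
  refine hprod _ _ fun j _ => hprod _ _ fun k _ => ?_
  rw [sub_eq_add_neg]
  refine (IsUltrametricDist.norm_add_le_max _ _).trans (max_le (norm_X_le j) ?_)
  rw [norm_neg]
  exact IsUltrametricDist.norm_natCast_le_one _ k

theorem point_descFactorial (n γ : σ → ℕ) :
    point (fun j => (n j : ℤ_[p])) (descFactorial γ) =
      (∏ j, ((γ j).factorial : ℚ_[p])) * ∏ j, ((n j).choose (γ j) : ℚ_[p]) := by
  rw [descFactorial, map_prod, ← Finset.prod_mul_distrib]
  refine Finset.prod_congr rfl fun j _ => ?_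
  rw [map_prod, ← Nat.cast_mul, ← Nat.descFactorial_eq_factorial_mul_choose]
  induction γ j with
  | zero => simp
  | succ k ih =>
    rw [Finset.prod_range_succ, ih, Nat.descFactorial_succ, mul_comm, Nat.cast_mul]
    rcases le_or_gt k (n j) with hk | hk
    · simp [Nat.cast_sub hk]
    · simp [Nat.descFactorial_of_lt hk]

/-- A family `c` with `c_γ / γ!` integral and tending to zero is the family of Mahler coefficients
of a series of Gauss norm at most one. -/
theorem exists_forall_point_eq_sum_choose [DecidableEq σ] (c : (σ → ℕ) → ℚ_[p])
    (hc : Tendsto (fun γ => c γ / ∏ j, ((γ j).factorial : ℚ_[p])) cofinite (𝓝 0))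
    (hc' : ∀ γ, ‖c γ / ∏ j, ((γ j).factorial : ℚ_[p])‖ ≤ 1) :
    ∃ F : TateAlgebra p σ, ‖F‖ ≤ 1 ∧ ∀ n : σ → ℕ, point (fun j => (n j : ℤ_[p])) F =
      ∑ γ ∈ Fintype.piFinset fun j => Finset.range (n j + 1),
        c γ * ∏ j, ((n j).choose (γ j) : ℚ_[p]) := by
  classical
  have hs : Summable fun γ : σ → ℕ =>
      (c γ / ∏ j, ((γ j).factorial : ℚ_[p])) • (descFactorial γ : TateAlgebra p σ) := by
    refine NonarchimedeanAddGroup.summable_of_tendsto_cofinite_zero ?_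
    refine squeeze_zero_norm (fun γ => (norm_smul_le _ _).trans
      (mul_le_of_le_one_right (norm_nonneg _) (norm_descFactorial_le γ))) ?_
    simpa using hc.norm
  refine ⟨∑' γ : σ → ℕ, (c γ / ∏ j, ((γ j).factorial : ℚ_[p])) • descFactorial γ, ?_,
    fun n => ?_⟩
  · exact IsUltrametricDist.norm_tsum_le_of_forall_le_of_nonneg zero_le_one fun γ =>
      (norm_smul_le _ _).trans (mul_le_one₀ (hc' γ) (norm_nonneg _) (norm_descFactorial_le γ))
  · have h := hs.hasSum.mapL (point fun j => (n j : ℤ_[p])).toContinuousLinearMap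
    have hterm : ∀ γ : σ → ℕ, c γ / (∏ j, ((γ j).factorial : ℚ_[p])) *
        point (fun j => (n j : ℤ_[p])) (descFactorial γ) =
          c γ * ∏ j, ((n j).choose (γ j) : ℚ_[p]) := fun γ => by
      have h0 : (∏ j, ((γ j).factorial : ℚ_[p])) ≠ 0 :=
        Finset.prod_ne_zero_iff.2 fun j _ => Nat.cast_ne_zero.2 (Nat.factorial_ne_zero _)
      rw [point_descFactorial, ← mul_assoc, div_mul_cancel₀ _ h0]
    simp only [map_smul, ContinuousAlgHom.coe_toContinuousLinearMap, smul_eq_mul, hterm] at h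
    refine h.unique (hasSum_sum_of_ne_finset_zero fun γ hγ => ?_)
    simp only [Fintype.mem_piFinset, Finset.mem_range, not_forall, not_lt] at hγ
    obtain ⟨j, hj⟩ := hγ
    rw [Finset.prod_eq_zero (Finset.mem_univ j), mul_zero]
    rw [Nat.choose_eq_zero_of_lt (by omega), Nat.cast_zero]

end TateAlgebra

/-! ### Elementary properties of `p`-valuations -/

namespace PValuation

variable {p : ℕ} {H : Type*} [Group H] (ω : PValuation p H)

theorem apply_one : ω 1 = ⊤ := (ω.eq_top_iff 1).2 rfl

theorem le_apply_inv (g : H) : ω g ≤ ω g⁻¹ := by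
  simpa [ω.apply_one] using ω.min_le_inv_mul g 1

theorem apply_inv (g : H) : ω g⁻¹ = ω g :=
  le_antisymm (by simpa using ω.le_apply_inv g⁻¹) (ω.le_apply_inv g)

theorem min_le_mul (g h : H) : min (ω g) (ω h) ≤ ω (g * h) := by
  simpa [ω.apply_inv] using ω.min_le_inv_mul g⁻¹ h

theorem le_mul {g h : H} {ν : ℝ≥0∞} (hg : ν ≤ ω g) (hh : ν ≤ ω h) : ν ≤ ω (g * h) :=
  (le_min hg hh).trans (ω.min_le_mul g h)

theorem le_list_prod {ν : ℝ≥0∞} (l : List H) (hl : ∀ g ∈ l, ν ≤ ω g) : ν ≤ ω l.prod := by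
  induction l with
  | nil => simp [ω.apply_one]
  | cons g l ih =>
    rw [List.prod_cons]
    exact ω.le_mul (hl g (by simp)) (ih fun x hx => hl x (by simp [hx]))

theorem le_conj (g u : H) : ω u ≤ ω (g * u * g⁻¹) := by
  have h : ω u ≤ ω (g * u * g⁻¹ * u⁻¹) := le_add_self.trans (ω.add_le_commutator g u)
  simpa using ω.le_mul h le_rfl

theorem apply_pow_p_pow (g : H) (k : ℕ) : ω (g ^ p ^ k) = ω g + k := by
  induction k with
  | zero => simp
  | succ k ih => rw [pow_succ, pow_mul, ω.pow_p, ih, Nat.cast_succ, add_assoc]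

theorem le_pow (g : H) (n : ℕ) : ω g ≤ ω (g ^ n) := by
  induction n with
  | zero => simp [ω.apply_one]
  | succ n ih => rw [pow_succ]; exact ω.le_mul ih le_rfl

/-- The normal subgroup `{ω ≥ ν}`. -/
def ball (ν : ℝ≥0∞) : Subgroup H where
  carrier := {g | ν ≤ ω g}
  mul_mem' := ω.le_mul
  one_mem' := by simp [ω.apply_one]
  inv_mem' := fun {g} hg => by simpa [ω.apply_inv] using hg

theorem mem_ball {ν : ℝ≥0∞} {g : H} : g ∈ ω.ball ν ↔ ν ≤ ω g := Iff.rfl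

instance normal_ball (ν : ℝ≥0∞) : (ω.ball ν).Normal :=
  ⟨fun u hu g => hu.trans (ω.le_conj g u)⟩

end PValuation

/-! ### Spans of weighted monomials -/

section WeightedSpan

variable {A : Type*} [Ring A] {ι : Type*}

/-- The additive group generated by the products `p^k z_{i_1} ⋯ z_{i_r}` with `[i_1, …, i_r] ∈ P`
of weight `k + w_{i_1} + ⋯ + w_{i_r}` at least `ν`. -/
def weightedSpan (p : ℕ) (z : ι → A) (w : ι → ℝ≥0∞) (P : Set (List ι)) (ν : ℝ≥0∞) :
    AddSubgroup A :=
  AddSubgroup.closure {a | ∃ (k : ℕ) (l : List ι), l ∈ P ∧ ν ≤ k + (l.map w).sum ∧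
    a = (p : A) ^ k * (l.map z).prod}

variable {p : ℕ} {z : ι → A} {w : ι → ℝ≥0∞} {P Q R : Set (List ι)} {μ ν : ℝ≥0∞}

theorem pow_mul_prod_mem_weightedSpan {k : ℕ} {l : List ι} (hl : l ∈ P)
    (hν : ν ≤ k + (l.map w).sum) : (p : A) ^ k * (l.map z).prod ∈ weightedSpan p z w P ν :=
  AddSubgroup.subset_closure ⟨k, l, hl, hν, rfl⟩

theorem weightedSpan_le {S : AddSubgroup A} (h : ∀ (k : ℕ), ∀ l ∈ P, ν ≤ k + (l.map w).sum →
    (p : A) ^ k * (l.map z).prod ∈ S) : weightedSpan p z w P ν ≤ S := by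
  refine (AddSubgroup.closure_le _).2 ?_
  rintro _ ⟨k, l, hl, hν, rfl⟩
  exact h k l hl hν

theorem weightedSpan_mono (hPQ : P ⊆ Q) (h : μ ≤ ν) :
    weightedSpan p z w P ν ≤ weightedSpan p z w Q μ :=
  weightedSpan_le fun _ _ hl hν => pow_mul_prod_mem_weightedSpan (hPQ hl) (h.trans hν)

theorem mul_mem_weightedSpan (hPQ : ∀ l ∈ P, ∀ m ∈ Q, l ++ m ∈ R) {a b : A}
    (ha : a ∈ weightedSpan p z w P μ) (hb : b ∈ weightedSpan p z w Q ν) :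
    a * b ∈ weightedSpan p z w R (μ + ν) := by
  induction ha using AddSubgroup.closure_induction with
  | mem a ha =>
    obtain ⟨k, l, hl, hμ, rfl⟩ := ha
    induction hb using AddSubgroup.closure_induction with
    | mem b hb =>
      obtain ⟨j, m, hm, hν, rfl⟩ := hb
      have : (p : A) ^ k * (l.map z).prod * ((p : A) ^ j * (m.map z).prod) =
          (p : A) ^ (k + j) * ((l ++ m).map z).prod := by
        rw [List.map_append, List.prod_append, pow_add]
        rw [mul_assoc, ← mul_assoc _ _ (m.map z).prod,
          ← ((Nat.cast_commute p _).pow_left j).eq]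
        simp only [mul_assoc]
      rw [this]
      refine pow_mul_prod_mem_weightedSpan (hPQ l hl m hm) ((add_le_add hμ hν).trans_eq ?_)
      rw [List.map_append, List.sum_append, Nat.cast_add]
      abel
    | zero => simp
    | add b c _ _ h₁ h₂ => rw [mul_add]; exact add_mem h₁ h₂
    | neg b _ h => rw [mul_neg]; exact neg_mem h
  | zero => simp
  | add a c _ _ h₁ h₂ => rw [add_mul]; exact add_mem h₁ h₂
  | neg a _ h => rw [neg_mul]; exact neg_mem h

theorem pow_mul_mem_weightedSpan (k : ℕ) {a : A} (ha : a ∈ weightedSpan p z w P ν) :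
    (p : A) ^ k * a ∈ weightedSpan p z w P (k + ν) :=
  mul_mem_weightedSpan (P := {[]}) (Q := P) (by simp) (by
    simpa using pow_mul_prod_mem_weightedSpan (p := p) (z := z) (w := w) (k := k) (l := [])
      (P := {[]}) (ν := k) rfl (by simp)) ha

end WeightedSpan

/-! ### The filtration of the group algebra -/

namespace PValuation

section Filtration

variable {p : ℕ} {H : Type*} [Group H] (ω : PValuation p H) {A : Type*} [Ring A] (ρ : H →* A)

/-- The `ν`-th step of the smallest multiplicative filtration for which `p` has weight `1` and
`ρ(g) - 1` has weight `ω(g)`. -/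
def filtration (ν : ℝ≥0∞) : AddSubgroup A :=
  weightedSpan p (fun g => ρ g - 1) ω Set.univ ν

variable {ω ρ} {μ ν : ℝ≥0∞} {a b : A}

theorem filtration_anti (h : μ ≤ ν) (ha : a ∈ ω.filtration ρ ν) : a ∈ ω.filtration ρ μ :=
  weightedSpan_mono subset_rfl h ha

theorem mul_mem_filtration (ha : a ∈ ω.filtration ρ μ) (hb : b ∈ ω.filtration ρ ν) :
    a * b ∈ ω.filtration ρ (μ + ν) :=
  mul_mem_weightedSpan (by simp) ha hb

variable (ω ρ) in
theorem map_sub_one_mem_filtration (g : H) : ρ g - 1 ∈ ω.filtration ρ (ω g) := by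
  simpa [filtration] using pow_mul_prod_mem_weightedSpan (p := p) (z := fun g => ρ g - 1) (w := ω)
    (k := 0) (l := [g]) (P := Set.univ) trivial (by simp)

theorem one_mem_filtration : (1 : A) ∈ ω.filtration ρ 0 := by
  simpa [filtration] using pow_mul_prod_mem_weightedSpan (p := p) (z := fun g => ρ g - 1) (w := ω)
    (k := 0) (l := []) (P := Set.univ) (ν := 0) trivial (by simp)

variable (ω ρ) in
theorem map_mem_filtration (g : H) : ρ g ∈ ω.filtration ρ 0 := by
  simpa using add_mem
    (filtration_anti (zero_le) (map_sub_one_mem_filtration ω ρ g)) one_mem_filtration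

theorem pow_mul_mem_filtration (k : ℕ) (ha : a ∈ ω.filtration ρ ν) :
    (p : A) ^ k * a ∈ ω.filtration ρ (k + ν) :=
  pow_mul_mem_weightedSpan k ha

theorem natCast_mul_mem_filtration (n : ℕ) (ha : a ∈ ω.filtration ρ ν) :
    (n : A) * a ∈ ω.filtration ρ ν := by
  rw [← nsmul_eq_mul]
  exact nsmul_mem ha n

theorem pow_mem_filtration (ha : a ∈ ω.filtration ρ ν) (n : ℕ) :
    a ^ n ∈ ω.filtration ρ (n * ν) := by
  induction n with
  | zero => simpa using one_mem_filtration
  | succ n ih =>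
    rw [pow_succ, Nat.cast_succ, add_mul, one_mul]
    exact mul_mem_filtration ih ha

/-- `(1 + a)^p - 1` agrees with `p a` to higher order: the intermediate binomial coefficients are
divisible by `p`, and `a^p` has weight at least `p ν`, which exceeds `ν + 1` as soon as
`ν > 1 / (p - 1)`. -/
theorem add_one_pow_sub_mem_filtration (hp : p.Prime) {ε : ℝ≥0∞} (ha : a ∈ ω.filtration ρ ν)
    (hε : ε ≤ ν) (hν : ν + 1 + ε ≤ p * ν) :
    (a + 1) ^ p - 1 - p * a ∈ ω.filtration ρ (ν + 1 + ε) := by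
  obtain ⟨q, rfl⟩ : ∃ q, p = q + 2 := ⟨p - 2, by have := hp.two_le; omega⟩
  rw [(Commute.one_right a).add_pow, Finset.sum_range_succ', Finset.sum_range_succ']
  have : ∀ s t : A, s + t + 1 - 1 - t = s := fun s t => by abel
  have hs : ∀ s : A, s + a ^ (0 + 1) * 1 ^ (q + 2 - (0 + 1)) * ((q + 2).choose (0 + 1) : A) +
      a ^ 0 * 1 ^ (q + 2 - 0) * ((q + 2).choose 0 : A) - 1 - ((q + 2 : ℕ) : A) * a = s :=
      fun s => by
    simp only [zero_add, pow_one, one_pow, mul_one, Nat.choose_one_right, pow_zero,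
      Nat.choose_zero_right, Nat.cast_one]
    rw [← (Nat.cast_commute (q + 2) a).eq, this]
  rw [hs]
  refine sum_mem fun m hm => ?_
  rw [Finset.mem_range] at hm
  have ham := pow_mem_filtration ha (m + 1 + 1)
  rw [one_pow, mul_one, ← (Nat.cast_commute _ _).eq]
  rcases Nat.lt_or_ge m q with hmq | hmq
  · obtain ⟨c, hc⟩ := hp.dvd_choose_self (k := m + 1 + 1) (by omega) (by omega)
    rw [hc, mul_comm (q + 2), Nat.cast_mul, mul_assoc]
    refine natCast_mul_mem_filtration c (filtration_anti ?_ (by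
      simpa using pow_mul_mem_filtration 1 ham))
    have h1 : ν + ε ≤ ((m + 1 + 1 : ℕ) : ℝ≥0∞) * ν := by
      calc ν + ε ≤ ν + ν := add_le_add_right hε ν
        _ = 2 * ν := (two_mul ν).symm
        _ ≤ _ := mul_le_mul_left
          (by push_cast; rw [add_assoc, one_add_one_eq_two]; exact le_add_self) ν
    calc ν + 1 + ε = 1 + (ν + ε) := by ring
      _ ≤ _ := by simpa using add_le_add_right h1 1
  · obtain rfl : m = q := by omega
    exact natCast_mul_mem_filtration _ (filtration_anti hν ham)

theorem map_pow_sub_mem_filtration (g : H) (m : ℕ) :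
    ρ (g ^ m) - 1 - m * (ρ g - 1) ∈ ω.filtration ρ (ω g + ω g) := by
  induction m with
  | zero => simp
  | succ m ih =>
    have : ρ (g ^ (m + 1)) - 1 - ((m + 1 : ℕ) : A) * (ρ g - 1) =
        (ρ (g ^ m) - 1 - m * (ρ g - 1)) + (ρ (g ^ m) - 1) * (ρ g - 1) := by
      rw [pow_succ, map_mul]
      push_cast
      noncomm_ring
    rw [this]
    exact add_mem ih (mul_mem_filtration
      (filtration_anti (ω.le_pow g m) (map_sub_one_mem_filtration ω ρ _))
      (map_sub_one_mem_filtration ω ρ g))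

theorem map_pow_p_pow_sub_mem_filtration (hp : p.Prime) {ε : ℝ≥0∞} {g : H} (hε : ε ≤ ω g)
    (hg : ω g + 1 + ε ≤ p * ω g) (k : ℕ) :
    ρ (g ^ p ^ k) - 1 - (p : A) ^ k * (ρ g - 1) ∈ ω.filtration ρ (k + ω g + ε) := by
  induction k with
  | zero => simp
  | succ k ih =>
    have h1 := add_one_pow_sub_mem_filtration (ε := ε) hp
      (map_sub_one_mem_filtration ω ρ (g ^ p ^ k)) (hε.trans (ω.le_pow _ _)) (by
        rw [ω.apply_pow_p_pow]
        calc ω g + k + 1 + ε = ω g + 1 + ε + 1 * k := by ring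
          _ ≤ p * ω g + p * k := add_le_add hg
            (mul_le_mul_left (by exact_mod_cast hp.one_lt.le) _)
          _ = p * (ω g + k) := by ring)
    have h2 := pow_mul_mem_filtration 1 ih
    have : ρ (g ^ p ^ (k + 1)) - 1 - (p : A) ^ (k + 1) * (ρ g - 1) =
        ((ρ (g ^ p ^ k) - 1 + 1) ^ p - 1 - p * (ρ (g ^ p ^ k) - 1)) +
        (p : A) ^ 1 * (ρ (g ^ p ^ k) - 1 - (p : A) ^ k * (ρ g - 1)) := by
      rw [sub_add_cancel, ← map_pow, ← pow_mul, ← pow_succ, pow_succ' (p : A) k, pow_one]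
      simp only [mul_sub, mul_assoc, mul_one]
      abel
    rw [this]
    refine add_mem (filtration_anti (le_of_eq ?_) h1) (filtration_anti (le_of_eq ?_) h2)
    · rw [ω.apply_pow_p_pow]; push_cast; ring
    · push_cast; ring

/-- `ρ(g^n) - 1` agrees with `n (ρ(g) - 1)` to higher order. -/
theorem map_pow_mul_sub_mem_filtration (hp : p.Prime) {ε : ℝ≥0∞} {g : H} (hε : ε ≤ ω g)
    (hg : ω g + 1 + ε ≤ p * ω g) (k m : ℕ) :
    ρ (g ^ (p ^ k * m)) - 1 - ((p ^ k * m : ℕ) : A) * (ρ g - 1) ∈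
      ω.filtration ρ (k + ω g + ε) := by
  have h1 := map_pow_sub_mem_filtration (ω := ω) (ρ := ρ) (g ^ p ^ k) m
  have h2 := natCast_mul_mem_filtration m
    (map_pow_p_pow_sub_mem_filtration (ρ := ρ) hp hε hg k)
  have : ρ (g ^ (p ^ k * m)) - 1 - ((p ^ k * m : ℕ) : A) * (ρ g - 1) =
      (ρ ((g ^ p ^ k) ^ m) - 1 - m * (ρ (g ^ p ^ k) - 1)) +
      m * (ρ (g ^ p ^ k) - 1 - (p : A) ^ k * (ρ g - 1)) := by
    rw [pow_mul, mul_comm (p ^ k) m]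
    push_cast
    simp only [mul_sub, mul_assoc, mul_one]
    abel
  rw [this]
  refine add_mem (filtration_anti ?_ h1) h2
  rw [ω.apply_pow_p_pow, add_comm (k : ℝ≥0∞)]
  exact add_le_add_right (hε.trans le_self_add) _

/-- `ρ(g_1 ⋯ g_r) - 1` agrees with `∑ (ρ(g_i) - 1)` to higher order. -/
theorem map_list_prod_sub_mem_filtration {ε : ℝ≥0∞} (hε : ε ≤ ν) (l : List H)
    (hl : ∀ g ∈ l, ν ≤ ω g) :
    ρ l.prod - 1 - (l.map fun g => ρ g - 1).sum ∈ ω.filtration ρ (ν + ε) := by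
  induction l with
  | nil => simp
  | cons g l ih =>
    have hl' : ∀ x ∈ l, ν ≤ ω x := fun x hx => hl x (by simp [hx])
    have : ρ (g :: l).prod - 1 - ((g :: l).map fun g => ρ g - 1).sum =
        (ρ l.prod - 1 - (l.map fun g => ρ g - 1).sum) + (ρ g - 1) * (ρ l.prod - 1) := by
      rw [List.prod_cons, map_mul, List.map_cons, List.sum_cons]
      noncomm_ring
    rw [this]
    refine add_mem (ih hl') (filtration_anti (add_le_add_right hε ν) (mul_mem_filtration
      (filtration_anti (hl g (by simp)) (map_sub_one_mem_filtration ω ρ g))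
      (filtration_anti (ω.le_list_prod l hl') (map_sub_one_mem_filtration ω ρ _))))

end Filtration

end PValuation

/-! ### Ordered monomials -/

section OrderedList

variable {d : ℕ}

/-- The increasing list in which `i` occurs `γ_i` times, encoding the ordered monomial
`z_1^{γ_1} ⋯ z_d^{γ_d}`. -/
def orderedList (γ : Fin d → ℕ) : List (Fin d) :=
  (List.ofFn fun i => List.replicate (γ i) i).flatten

theorem orderedList_count_perm (l : List (Fin d)) :
    (orderedList fun i => l.count i).Perm l := by
  rw [List.perm_iff_count]
  intro a
  simp [orderedList, List.count_flatten, List.map_ofFn, List.sum_ofFn, List.count_replicate]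

theorem prod_map_orderedList {A : Type*} [Monoid A] (γ : Fin d → ℕ) (z : Fin d → A) :
    ((orderedList γ).map z).prod = (List.ofFn fun i => z i ^ γ i).prod := by
  simp [orderedList, List.map_flatten, List.prod_flatten, List.map_ofFn, Function.comp_def]

theorem sum_map_orderedList {A : Type*} [AddCommMonoid A] (γ : Fin d → ℕ) (w : Fin d → A) :
    ((orderedList γ).map w).sum = ∑ i, γ i • w i := by
  simp [orderedList, List.map_flatten, List.sum_flatten, List.map_ofFn, Function.comp_def,
    List.sum_ofFn]

/-- Expansion of an ordered product of sums in a noncommutative ring. -/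
theorem prod_ofFn_sum {A : Type*} [Ring A] {κ : Type*} [DecidableEq κ] (s : Fin d → Finset κ)
    (f : Fin d → κ → A) :
    (List.ofFn fun i => ∑ n ∈ s i, f i n).prod =
      ∑ γ ∈ Fintype.piFinset s, (List.ofFn fun i => f i (γ i)).prod := by
  induction d with
  | zero => simp
  | succ d ih =>
    rw [List.ofFn_succ, List.prod_cons, ih, Finset.sum_mul_sum, ← Finset.sum_product']
    refine Finset.sum_nbij' (fun x => Fin.cons x.1 x.2) (fun γ => (γ 0, Fin.tail γ)) ?_ ?_ ?_ ?_ ?_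
    · rintro ⟨a, γ⟩ hx
      simp only [Finset.mem_product, Fintype.mem_piFinset] at hx ⊢
      exact Fin.cases (by simpa using hx.1) fun i => by simpa using hx.2 i
    · intro γ hγ
      simp only [Finset.mem_product, Fintype.mem_piFinset] at hγ ⊢
      exact ⟨hγ 0, fun i => hγ i.succ⟩
    · rintro ⟨a, γ⟩ _
      simp
    · intro γ _
      simp
    · rintro ⟨a, γ⟩ _
      simp [List.ofFn_succ]

/-- The Mahler expansion of `n ↦ g_1^{n_1} ⋯ g_m^{n_m}` in terms of ordered monomials. -/
theorem map_prod_ofFn_pow {H A : Type*} [Group H] [Ring A] (ρ : H →* A) (g : Fin d → H)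
    (n : Fin d → ℕ) :
    ρ (List.ofFn fun i => g i ^ n i).prod =
      ∑ γ ∈ Fintype.piFinset fun i => Finset.range (n i + 1),
        (∏ i, (n i).choose (γ i)) • (List.ofFn fun i => (ρ (g i) - 1) ^ γ i).prod := by
  have h1 : ∀ i, ρ (g i ^ n i) =
      ∑ k ∈ Finset.range (n i + 1), (n i).choose k • (ρ (g i) - 1) ^ k := fun i => by
    conv_lhs => rw [map_pow, ← sub_add_cancel (ρ (g i)) 1, (Commute.one_right _).add_pow]
    exact Finset.sum_congr rfl fun k _ => by rw [one_pow, mul_one, nsmul_eq_mul, Nat.cast_comm]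
  rw [map_list_prod, List.map_ofFn]
  simp only [Function.comp_def, h1]
  rw [prod_ofFn_sum]
  refine Finset.sum_congr rfl fun γ hγ => ?_
  clear h1 hγ
  induction d with
  | zero => simp
  | succ d ih =>
    rw [List.ofFn_succ, List.prod_cons, ih (fun i => g i.succ), Fin.prod_univ_succ, List.ofFn_succ,
      List.prod_cons, smul_mul_smul_comm]

end OrderedList

/-! ### Ordered bases -/

namespace PValuation

section OrderedBasis

variable {p : ℕ} [Fact p.Prime] {H : Type*} [Group H] [TopologicalSpace H] [IsTopologicalGroup H]
  {ω : PValuation p H} {d : ℕ} {h : Fin d → H}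

theorem tendsto_zpow (hω : ω.DefinesTopology) (g : H) (n : ℤ) :
    Tendsto (fun m : ℤ => g ^ m) (comap (fun m : ℤ => (m : ℤ_[p])) (𝓝 (n : ℤ_[p])))
      (𝓝 (g ^ n)) := by
  have hb : (𝓝 (g ^ n)).HasBasis (fun ν : ℝ≥0∞ => ν < ⊤) fun ν => {x | ν ≤ ω ((g ^ n)⁻¹ * x)} := by
    rw [← map_mul_left_nhds_one (g ^ n)]
    refine (hω.map _).congr (fun _ => Iff.rfl) fun ν _ => ?_
    ext x
    simp
  refine hb.tendsto_right_iff.2 fun ν hν => ?_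
  obtain ⟨k, hk⟩ := ENNReal.exists_nat_gt hν.ne
  have hU : Metric.closedBall (n : ℤ_[p]) ((p : ℝ) ^ (-(k : ℤ))) ∈ 𝓝 (n : ℤ_[p]) :=
    Metric.closedBall_mem_nhds _ (zpow_pos (by exact_mod_cast (Fact.out : p.Prime).pos) _)
  filter_upwards [preimage_mem_comap hU] with m hm
  rw [Set.mem_preimage, mem_closedBall_iff_norm, ← Int.cast_sub,
    PadicInt.norm_int_le_pow_iff_dvd] at hm
  obtain ⟨j, hj⟩ := hm
  have : (g ^ n)⁻¹ * g ^ m = (g ^ p ^ k) ^ j := by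
    rw [← zpow_neg, ← zpow_add, ← zpow_natCast, ← zpow_mul, neg_add_eq_sub, hj]
    push_cast
    rfl
  rw [this]
  exact (ω.ball ν).zpow_mem (by
    rw [mem_ball, ω.apply_pow_p_pow]
    exact hk.le.trans le_add_self) j

/-- The `p`-adic powers extend the ordinary ones; the limit in their definition exists because
`ω(g^{p^k}) = ω(g) + k` tends to infinity. -/
theorem padicPow_natCast [T2Space H] (hω : ω.DefinesTopology) (g : H) (n : ℕ) :
    padicPow g (n : ℤ_[p]) = g ^ n := by
  have : (comap (fun m : ℤ => (m : ℤ_[p])) (𝓝 (n : ℤ_[p]))).NeBot :=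
    comap_neBot fun t ht => ⟨n, by simpa using mem_of_mem_nhds ht⟩
  have ht := tendsto_zpow hω g n
  rw [Int.cast_natCast, zpow_natCast] at ht
  exact ht.limUnder_eq

namespace IsOrderedBasis

section
omit [IsTopologicalGroup H]

/-- The coordinates of an element with respect to an ordered basis. -/
noncomputable def coord (hh : ω.IsOrderedBasis h) (g : H) : Fin d → ℤ_[p] :=
  hh.isHomeomorph.homeomorph.symm g

variable (hh : ω.IsOrderedBasis h)
include hh

theorem t2Space : T2Space H := hh.isHomeomorph.homeomorph.t2Space

theorem compactSpace : CompactSpace H := hh.isHomeomorph.homeomorph.compactSpace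

theorem continuous_coord : Continuous hh.coord := hh.isHomeomorph.homeomorph.symm.continuous

@[simp] theorem orderedProd_coord (g : H) : orderedProd h (hh.coord g) = g :=
  hh.isHomeomorph.homeomorph.apply_symm_apply g

@[simp] theorem coord_orderedProd (x : Fin d → ℤ_[p]) : hh.coord (orderedProd h x) = x :=
  hh.isHomeomorph.homeomorph.symm_apply_apply x

end

variable (hω : ω.DefinesTopology) (hh : ω.IsOrderedBasis h)
include hω hh

theorem orderedProd_natCast (n : Fin d → ℕ) :
    orderedProd h (fun i => (n i : ℤ_[p])) = (List.ofFn fun i => h i ^ n i).prod := by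
  have := hh.t2Space
  simp only [orderedProd, padicPow_natCast hω]

/-- The elements `h_1^{n_1} ⋯ h_d^{n_d}` with natural exponents are dense. -/
theorem exists_natCast_approx (g : H) {ν : ℝ≥0∞} (hν : ν < ⊤) :
    ∃ n : Fin d → ℕ, ν ≤ ω ((orderedProd h fun i => (n i : ℤ_[p]))⁻¹ * g) := by
  have hdense : DenseRange fun (n : Fin d → ℕ) (i : Fin d) => (n i : ℤ_[p]) :=
    DenseRange.piMap fun _ => PadicInt.denseRange_natCast
  have hcont : Continuous fun x : Fin d → ℤ_[p] => (orderedProd h x)⁻¹ * g :=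
    hh.isHomeomorph.continuous.inv.mul continuous_const
  have hnhds : {x : Fin d → ℤ_[p] | ν ≤ ω ((orderedProd h x)⁻¹ * g)} ∈ 𝓝 (hh.coord g) := by
    refine hcont.continuousAt.preimage_mem_nhds (t := {u | ν ≤ ω u}) ?_
    rw [hh.orderedProd_coord, inv_mul_cancel]
    exact hω.mem_of_mem hν
  obtain ⟨_, ⟨n, rfl⟩, hn⟩ := Dense.inter_nhds_nonempty hdense hnhds
  exact ⟨n, hn⟩

variable {A : Type*} [Ring A] (ρ : H →* A) {ε : ℝ≥0∞}

/-- `ρ(g) - 1` agrees to higher order with a combination of the `ρ(h_i) - 1`. -/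
theorem map_sub_one_mem_sup (hε' : ε < ⊤) (hε : ∀ g, ε ≤ ω g)
    (hb : ∀ i, ω (h i) + 1 + ε ≤ p * ω (h i)) (g : H) :
    ρ g - 1 ∈ weightedSpan p (fun i => ρ (h i) - 1) (fun i => ω (h i)) {l | l.length = 1} (ω g) ⊔
      ω.filtration ρ (ω g + ε) := by
  rcases eq_or_ne g 1 with rfl | hg
  · simp
  have hp : p.Prime := Fact.out
  have hgt : ω g < ⊤ := lt_top_iff_ne_top.2 fun hc => hg ((ω.eq_top_iff g).1 hc)
  obtain ⟨n, hn⟩ := exists_natCast_approx hω hh g (ENNReal.add_lt_top.2 ⟨hgt, hε'⟩)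
  set g' := orderedProd h fun i => (n i : ℤ_[p]) with hg'
  have hωg' : ω g ≤ ω g' := by
    have := ω.le_mul le_rfl (le_self_add.trans (hn.trans (ω.le_apply_inv _)))
    simpa using this
  have hle : ∀ i, ω g ≤ ((emultiplicity (p : ℤ_[p]) (n i) : ℕ∞) : ℝ≥0∞) + ω (h i) := fun i => by
    rw [hg', hh.apply_orderedProd] at hωg'
    exact hωg'.trans (iInf_le _ i)
  have hfac : ∀ i, n i = 0 ∨ ∃ k m : ℕ, n i = p ^ k * m ∧ ω g ≤ k + ω (h i) := fun i => by
    rcases eq_or_ne (n i) 0 with h0 | h0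
    · exact Or.inl h0
    right
    have hfin : FiniteMultiplicity (p : ℤ_[p]) (n i) :=
      FiniteMultiplicity.of_not_isUnit PadicInt.p_nonunit (Nat.cast_ne_zero.2 h0)
    obtain ⟨m, hm⟩ : p ^ multiplicity (p : ℤ_[p]) (n i) ∣ n i := by
      have := pow_multiplicity_dvd (p : ℤ_[p]) (n i)
      have h2 := (PadicInt.pow_p_dvd_int_iff (p := p) (multiplicity (p : ℤ_[p]) (n i)) (n i)).1
        (by exact_mod_cast this)
      exact_mod_cast h2
    refine ⟨_, m, hm, ?_⟩
    have := hle i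
    rwa [hfin.emultiplicity_eq_multiplicity] at this
  -- `g = g' u` with `u` of large valuation, and `g' = ∏ h_i ^ n_i`.
  have h1 : ρ g - ρ g' ∈ ω.filtration ρ (ω g + ε) := by
    have : ρ g - ρ g' = ρ g' * (ρ (g'⁻¹ * g) - 1) := by
      rw [mul_sub, ← map_mul, mul_inv_cancel_left, mul_one]
    rw [this]
    simpa using mul_mem_filtration (map_mem_filtration ω ρ g')
      (filtration_anti hn (map_sub_one_mem_filtration ω ρ _))
  have h2 : ρ g' - 1 - ∑ i, (ρ (h i ^ n i) - 1) ∈ ω.filtration ρ (ω g + ε) := by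
    rw [hg', orderedProd_natCast hω hh]
    have := map_list_prod_sub_mem_filtration (ω := ω) (ρ := ρ) (hε g)
      (List.ofFn fun i => h i ^ n i) (by
        intro x hx
        obtain ⟨i, rfl⟩ := (List.mem_ofFn' _ _).1 hx
        rcases hfac i with h0 | ⟨k, m, hkm, hk⟩
        · simp [h0, ω.apply_one]
        · change _ ≤ ω (h i ^ n i)
          rw [hkm, pow_mul]
          refine le_trans ?_ (ω.le_pow _ _)
          rw [ω.apply_pow_p_pow, add_comm]
          exact hk)
    rwa [List.map_ofFn, List.sum_ofFn] at this
  have h3 : ∀ i, ρ (h i ^ n i) - 1 - n i * (ρ (h i) - 1) ∈ ω.filtration ρ (ω g + ε) := fun i => by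
    rcases hfac i with h0 | ⟨k, m, hkm, hk⟩
    · simp [h0]
    · rw [hkm]
      exact filtration_anti (by gcongr) (map_pow_mul_sub_mem_filtration hp (hε _) (hb i) k m)
  have h4 : ∑ i, n i * (ρ (h i) - 1) ∈ weightedSpan p (fun i => ρ (h i) - 1)
      (fun i => ω (h i)) {l | l.length = 1} (ω g) := sum_mem fun i _ => by
    rcases hfac i with h0 | ⟨k, m, hkm, hk⟩
    · simp [h0]
    · rw [hkm, mul_comm, Nat.cast_mul, mul_assoc, ← nsmul_eq_mul, Nat.cast_pow]
      refine nsmul_mem ?_ m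
      simpa using pow_mul_prod_mem_weightedSpan (p := p) (z := fun i => ρ (h i) - 1)
        (w := fun i => ω (h i)) (P := {l | l.length = 1}) (l := [i]) (k := k) (by simp)
        (by simpa using hk)
  refine AddSubgroup.mem_sup.2 ⟨_, h4, _,
    add_mem (add_mem h1 h2) (sum_mem (t := Finset.univ) fun i _ => h3 i), ?_⟩
  rw [Finset.sum_sub_distrib (f := fun i => ρ (h i ^ n i) - 1)]
  abel

/-- Interchanging two of the `ρ(h_i) - 1` changes a product by linear terms and terms of higher
order, because of the condition on commutators. -/
theorem mul_sub_mul_mem_sup (hε' : ε < ⊤) (hε : ∀ g, ε ≤ ω g)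
    (hb : ∀ i, ω (h i) + 1 + ε ≤ p * ω (h i)) (i j : Fin d) :
    (ρ (h j) - 1) * (ρ (h i) - 1) - (ρ (h i) - 1) * (ρ (h j) - 1) ∈
      weightedSpan p (fun i => ρ (h i) - 1) (fun i => ω (h i)) {l | l.length = 1}
        (ω (h j) + ω (h i)) ⊔ ω.filtration ρ (ω (h j) + ω (h i) + ε) := by
  have hc := ω.add_le_commutator (h j) (h i)
  set c := h j * h i * (h j)⁻¹ * (h i)⁻¹ with hcdef
  have : (ρ (h j) - 1) * (ρ (h i) - 1) - (ρ (h i) - 1) * (ρ (h j) - 1) =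
      (ρ c - 1) + (ρ c - 1) * (ρ (h i * h j) - 1) := by
    have h1 : ρ c * (ρ (h i) * ρ (h j)) = ρ (h j) * ρ (h i) := by
      rw [← map_mul, ← map_mul, ← map_mul]
      congr 1
      rw [hcdef]
      group
    rw [map_mul ρ (h i) (h j), mul_sub (ρ c - 1), sub_mul (ρ c), h1]
    noncomm_ring
  rw [this]
  refine add_mem ?_ (AddSubgroup.mem_sup_right (mul_mem_filtration
    (filtration_anti hc (map_sub_one_mem_filtration ω ρ c))
    (filtration_anti (hε _) (map_sub_one_mem_filtration ω ρ _))))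
  exact sup_le_sup (weightedSpan_mono subset_rfl hc)
    (weightedSpan_mono subset_rfl (add_le_add_left hc ε)) (map_sub_one_mem_sup hω hh ρ hε' hε hb c)

/-- Modulo shorter products and terms of higher order, a product of `ρ(h_i) - 1` does not depend
on the order of its factors. -/
theorem prod_sub_prod_mem_sup_of_perm (hε' : ε < ⊤) (hε : ∀ g, ε ≤ ω g)
    (hb : ∀ i, ω (h i) + 1 + ε ≤ p * ω (h i)) {l l' : List (Fin d)} (hl : l.Perm l') :
    (l.map fun i => ρ (h i) - 1).prod - (l'.map fun i => ρ (h i) - 1).prod ∈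
      weightedSpan p (fun i => ρ (h i) - 1) (fun i => ω (h i)) {m | m.length < l.length}
        (l.map fun i => ω (h i)).sum ⊔ ω.filtration ρ ((l.map fun i => ω (h i)).sum + ε) := by
  induction hl with
  | nil => simp
  | cons i hl ih =>
    rename_i l l'
    obtain ⟨y, hy, z, hz, hyz⟩ := AddSubgroup.mem_sup.1 ih
    simp only [List.map_cons, List.prod_cons, List.sum_cons]
    rw [← mul_sub, ← hyz, mul_add]
    refine AddSubgroup.mem_sup.2 ⟨_, ?_, _, ?_, rfl⟩
    · refine mul_mem_weightedSpan (P := {[i]}) (Q := {m | m.length < l.length})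
        (fun l hl m hm => by rw [Set.mem_singleton_iff.1 hl]; simpa using hm) ?_ hy
      simpa using pow_mul_prod_mem_weightedSpan (p := p) (z := fun i => ρ (h i) - 1)
        (w := fun i => ω (h i)) (P := {[i]}) (l := [i]) (k := 0) rfl (by simp)
    · rw [add_assoc]
      exact mul_mem_filtration (map_sub_one_mem_filtration ω ρ (h i)) hz
  | swap i j l =>
    obtain ⟨y, hy, z, hz, hyz⟩ := AddSubgroup.mem_sup.1
      (mul_sub_mul_mem_sup hω hh ρ hε' hε hb i j)
    have hl : (l.map fun i => ρ (h i) - 1).prod ∈ weightedSpan p (fun i => ρ (h i) - 1)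
        (fun i => ω (h i)) {l} (l.map fun i => ω (h i)).sum := by
      simpa using pow_mul_prod_mem_weightedSpan (p := p) (z := fun i => ρ (h i) - 1)
        (w := fun i => ω (h i)) (P := {l}) (l := l) (k := 0) rfl (by simp)
    have hl' : (l.map fun i => ρ (h i) - 1).prod ∈ ω.filtration ρ (l.map fun i => ω (h i)).sum := by
      have := pow_mul_prod_mem_weightedSpan (p := p) (z := fun g => ρ g - 1)
        (w := ω) (P := Set.univ) (l := l.map h) (k := 0) (ν := (l.map fun i => ω (h i)).sum)
        trivial (by simp [Function.comp_def])
      simpa [filtration, Function.comp_def] using this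
    simp only [List.map_cons, List.prod_cons, List.sum_cons, ← mul_assoc]
    rw [← sub_mul, ← hyz, add_mul, ← add_assoc]
    refine AddSubgroup.mem_sup.2 ⟨_, ?_, _, ?_, rfl⟩
    · exact mul_mem_weightedSpan (P := {l | l.length = 1}) (Q := {l})
        (by simp +contextual [add_comm]) hy hl
    · rw [add_right_comm]
      exact mul_mem_filtration hz hl'
  | trans h₁ h₂ ih₁ ih₂ =>
    rename_i l₁ l₂ l₃
    rw [← (h₁.map fun i => ω (h i)).sum_eq, ← h₁.length_eq] at ih₂
    have := add_mem ih₁ ih₂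
    rwa [sub_add_sub_cancel] at this

/-- A product of `ρ(h_i) - 1` is a combination of ordered monomials, modulo terms of higher
order. -/
theorem prod_mem_sup (hε' : ε < ⊤) (hε : ∀ g, ε ≤ ω g)
    (hb : ∀ i, ω (h i) + 1 + ε ≤ p * ω (h i)) (l : List (Fin d)) :
    (l.map fun i => ρ (h i) - 1).prod ∈
      weightedSpan p (fun i => ρ (h i) - 1) (fun i => ω (h i)) (Set.range orderedList)
        (l.map fun i => ω (h i)).sum ⊔ ω.filtration ρ ((l.map fun i => ω (h i)).sum + ε) := by
  induction hn : l.length using Nat.strong_induction_on generalizing l with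
  | _ n ih =>
    have hperm := orderedList_count_perm l
    have h1 := prod_sub_prod_mem_sup_of_perm hω hh ρ hε' hε hb hperm.symm
    have h2 : ((orderedList fun i => l.count i).map fun i => ρ (h i) - 1).prod ∈
        weightedSpan p (fun i => ρ (h i) - 1) (fun i => ω (h i)) (Set.range orderedList)
        (l.map fun i => ω (h i)).sum := by
      simpa using pow_mul_prod_mem_weightedSpan (p := p) (z := fun i => ρ (h i) - 1)
        (w := fun i => ω (h i)) (P := (Set.range orderedList)) (l := orderedList fun i => l.count i)
        (k := 0) ⟨_, rfl⟩
        (by rw [(hperm.map fun i => ω (h i)).sum_eq, Nat.cast_zero, zero_add])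
    have h3 : weightedSpan p (fun i => ρ (h i) - 1) (fun i => ω (h i)) {m | m.length < l.length}
        (l.map fun i => ω (h i)).sum ≤
        weightedSpan p (fun i => ρ (h i) - 1) (fun i => ω (h i)) (Set.range orderedList)
        (l.map fun i => ω (h i)).sum ⊔ ω.filtration ρ ((l.map fun i => ω (h i)).sum + ε) :=
      weightedSpan_le fun k m hm hw => by
        obtain ⟨y, hy, z, hz, hyz⟩ := AddSubgroup.mem_sup.1 (ih _ (hn ▸ hm) m rfl)
        rw [← hyz, mul_add]
        refine AddSubgroup.mem_sup.2 ⟨_, weightedSpan_mono subset_rfl hw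
          (pow_mul_mem_weightedSpan k hy), _, ?_, rfl⟩
        refine filtration_anti ?_ (pow_mul_mem_filtration k hz)
        rw [← add_assoc]
        exact add_le_add_left hw ε
    have := add_mem ((sup_le h3 le_sup_right) h1) (AddSubgroup.mem_sup_left h2)
    rwa [sub_add_cancel] at this

/-- The filtration is spanned by ordered monomials, modulo higher order terms. -/
theorem filtration_le_sup (hε' : ε < ⊤) (hε : ∀ g, ε ≤ ω g)
    (hb : ∀ i, ω (h i) + 1 + ε ≤ p * ω (h i)) (ν : ℝ≥0∞) :
    ω.filtration ρ ν ≤ weightedSpan p (fun i => ρ (h i) - 1) (fun i => ω (h i))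
      (Set.range orderedList) ν ⊔ ω.filtration ρ (ν + ε) := by
  -- Every generator is a combination of products of the `ρ(h_i) - 1`, modulo higher order terms.
  have h1 : ∀ l : List H, (l.map fun g => ρ g - 1).prod ∈
      weightedSpan p (fun i => ρ (h i) - 1) (fun i => ω (h i)) Set.univ (l.map ω).sum ⊔
        ω.filtration ρ ((l.map ω).sum + ε) := by
    intro l
    induction l with
    | nil =>
      refine AddSubgroup.mem_sup_left ?_
      simpa using pow_mul_prod_mem_weightedSpan (p := p) (z := fun i => ρ (h i) - 1)
        (w := fun i => ω (h i)) (P := Set.univ) (l := []) (k := 0) (ν := 0) trivial (by simp)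
    | cons g l ih =>
      obtain ⟨y, hy, z, hz, hyz⟩ := AddSubgroup.mem_sup.1 ih
      obtain ⟨y', hy', z', hz', hyz'⟩ := AddSubgroup.mem_sup.1
        (map_sub_one_mem_sup hω hh ρ hε' hε hb g)
      have hl : (l.map fun g => ρ g - 1).prod ∈ ω.filtration ρ (l.map ω).sum := by
        have := pow_mul_prod_mem_weightedSpan (p := p) (z := fun g => ρ g - 1)
          (w := ω) (P := Set.univ) (l := l) (k := 0) (ν := (l.map ω).sum) trivial (by simp)
        simpa [filtration] using this
      have hy'' : y' ∈ ω.filtration ρ (ω g) := by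
        rw [eq_sub_of_add_eq hyz']
        exact sub_mem (map_sub_one_mem_filtration ω ρ g) (filtration_anti le_self_add hz')
      simp only [List.map_cons, List.prod_cons, List.sum_cons]
      have : (ρ g - 1) * (l.map fun g => ρ g - 1).prod =
          y' * y + (y' * z + z' * (l.map fun g => ρ g - 1).prod) := by
        rw [← hyz', add_mul, ← hyz]
        noncomm_ring
      rw [this]
      refine AddSubgroup.mem_sup.2 ⟨_, mul_mem_weightedSpan (by simp) hy' hy, _, add_mem ?_ ?_, rfl⟩
      · rw [add_assoc]
        exact mul_mem_filtration hy'' hz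
      · rw [add_right_comm]
        exact mul_mem_filtration hz' hl
  have h2 : weightedSpan p (fun i => ρ (h i) - 1) (fun i => ω (h i)) Set.univ ν ≤
      weightedSpan p (fun i => ρ (h i) - 1) (fun i => ω (h i)) (Set.range orderedList) ν ⊔
        ω.filtration ρ (ν + ε) :=
    weightedSpan_le fun k l _ hw => by
      obtain ⟨y, hy, z, hz, hyz⟩ := AddSubgroup.mem_sup.1 (prod_mem_sup hω hh ρ hε' hε hb l)
      rw [← hyz, mul_add]
      refine AddSubgroup.mem_sup.2 ⟨_, weightedSpan_mono subset_rfl hw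
        (pow_mul_mem_weightedSpan k hy), _, ?_, rfl⟩
      refine filtration_anti ?_ (pow_mul_mem_filtration k hz)
      rw [← add_assoc]
      exact add_le_add_left hw ε
  refine weightedSpan_le fun k l _ hw => ?_
  obtain ⟨y, hy, z, hz, hyz⟩ := AddSubgroup.mem_sup.1 (h1 l)
  rw [← hyz, mul_add]
  refine add_mem (h2 (weightedSpan_mono subset_rfl hw (pow_mul_mem_weightedSpan k hy)))
    (AddSubgroup.mem_sup_right (filtration_anti ?_ (pow_mul_mem_filtration k hz)))
  rw [← add_assoc]
  exact add_le_add_left hw ε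

/-- The filtration is spanned by ordered monomials, modulo terms of arbitrarily high order. -/
theorem filtration_le_sup_natCast (hε₀ : ε ≠ 0) (hε' : ε < ⊤) (hε : ∀ g, ε ≤ ω g)
    (hb : ∀ i, ω (h i) + 1 + ε ≤ p * ω (h i)) (ν : ℝ≥0∞) (N : ℕ) :
    ω.filtration ρ ν ≤ weightedSpan p (fun i => ρ (h i) - 1) (fun i => ω (h i))
      (Set.range orderedList) ν ⊔ ω.filtration ρ N := by
  have key : ∀ n : ℕ, ω.filtration ρ ν ≤ weightedSpan p (fun i => ρ (h i) - 1) (fun i => ω (h i))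
      (Set.range orderedList) ν ⊔ ω.filtration ρ (ν + n * ε) := by
    intro n
    induction n with
    | zero => simp
    | succ n ih =>
      refine ih.trans (sup_le le_sup_left
        ((filtration_le_sup hω hh ρ hε' hε hb _).trans (sup_le_sup ?_ ?_)))
      · exact weightedSpan_mono subset_rfl le_self_add
      · rw [Nat.cast_succ, add_mul, one_mul, add_assoc]
  obtain ⟨n, hn⟩ := ENNReal.exists_nat_mul_gt hε₀ (ENNReal.natCast_ne_top N)
  exact (key n).trans (sup_le_sup_left
    (fun a ha => filtration_anti (hn.le.trans le_add_self) ha) _)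

end IsOrderedBasis

end OrderedBasis

end PValuation

/-! ### Unipotence of actions of `p`-groups on finite `p`-torsion groups -/

section Unipotent

variable {p : ℕ} [Fact p.Prime] {Q : Type*} [Group Q] {V : Type*} [AddCommGroup V]

/-- The ascending chain of submodules of `V` with `V_0 = 0` and `V_{r+1} / V_r = (V / V_r)^Q`. -/
def unipotentChain (σ : Q →* Module.End ℤ V) : ℕ → Submodule ℤ V
  | 0 => ⊥
  | r + 1 => ⨅ g, (unipotentChain σ r).comap (σ g - 1)

variable (σ : Q →* Module.End ℤ V)

theorem mem_unipotentChain_succ {r : ℕ} {v : V} :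
    v ∈ unipotentChain σ (r + 1) ↔ ∀ g, σ g v - v ∈ unipotentChain σ r := by
  simp [unipotentChain, Submodule.mem_iInf, LinearMap.sub_apply]

theorem map_mem_unipotentChain {r : ℕ} {v : V} (hv : v ∈ unipotentChain σ r) (g : Q) :
    σ g v ∈ unipotentChain σ r := by
  induction r generalizing v with
  | zero =>
    obtain rfl : v = 0 := by simpa [unipotentChain] using hv
    simp
  | succ r ih =>
    rw [mem_unipotentChain_succ] at hv ⊢
    intro x
    have h : σ x (σ g v) = σ g (σ (g⁻¹ * x * g) v) := by
      rw [← Module.End.mul_apply, ← Module.End.mul_apply, ← map_mul, ← map_mul]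
      congr 2
      group
    rw [h, ← map_sub]
    exact ih (hv _)

theorem monotone_unipotentChain : Monotone (unipotentChain σ) := by
  refine monotone_nat_of_le_succ fun r => ?_
  intro v hv
  rw [mem_unipotentChain_succ]
  exact fun g => sub_mem (map_mem_unipotentChain σ hv g) hv

/-- If `V_r ≠ V`, then the `p`-group `Q` has a nonzero fixed point on `V / V_r`. -/
theorem unipotentChain_succ_ne [Finite V] (hQ : IsPGroup p Q) {K : ℕ}
    (hV : ∀ v : V, p ^ K • v = 0) {r : ℕ} (hr : unipotentChain σ r ≠ ⊤) :
    unipotentChain σ r ≠ unipotentChain σ (r + 1) := by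
  set W := unipotentChain σ r with hW
  have hle : ∀ g, W ≤ W.comap (σ g) := fun g v hv => map_mem_unipotentChain σ hv g
  let act : MulAction Q (V ⧸ W) :=
    { smul g := W.mapQ W (σ g) (hle g)
      one_smul x := by
        obtain ⟨v, rfl⟩ := Submodule.Quotient.mk_surjective W x
        change W.mapQ W (σ 1) (hle 1) (Submodule.Quotient.mk v) = Submodule.Quotient.mk v
        rw [Submodule.mapQ_apply, map_one, Module.End.one_apply]
      mul_smul g g' x := by
        obtain ⟨v, rfl⟩ := Submodule.Quotient.mk_surjective W x
        change W.mapQ W (σ (g * g')) (hle _) (Submodule.Quotient.mk v) =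
          W.mapQ W (σ g) (hle g) (W.mapQ W (σ g') (hle g') (Submodule.Quotient.mk v))
        rw [Submodule.mapQ_apply, Submodule.mapQ_apply, Submodule.mapQ_apply, map_mul,
          Module.End.mul_apply] }
  have hsmul : ∀ (g : Q) (v : V), 
      g • (Submodule.Quotient.mk v : V ⧸ W) = Submodule.Quotient.mk (σ g v) := fun g v => rfl
  have hfin : Finite (V ⧸ W) := Finite.of_surjective _ (Submodule.Quotient.mk_surjective W)
  have hnt : Nontrivial (V ⧸ W) := by
    rwa [Submodule.Quotient.nontrivial_iff]
  have hcard : p ∣ Nat.card (V ⧸ W) := by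
    obtain ⟨q, hq, hqd⟩ := Nat.exists_prime_and_dvd (Finite.one_lt_card (α := V ⧸ W)).ne'
    have : Fact q.Prime := ⟨hq⟩
    have := Fintype.ofFinite (V ⧸ W)
    rw [Nat.card_eq_fintype_card] at hqd ⊢
    obtain ⟨x, hx⟩ := exists_prime_addOrderOf_dvd_card q hqd
    have hx0 : p ^ K • x = 0 := by
      obtain ⟨v, rfl⟩ := Submodule.Quotient.mk_surjective W x
      rw [← Submodule.Quotient.mk_smul, hV, Submodule.Quotient.mk_zero]
    have h1 : q ∣ p ^ K := hx ▸ addOrderOf_dvd_of_nsmul_eq_zero hx0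
    rwa [← (Nat.prime_dvd_prime_iff_eq hq Fact.out).1 (hq.dvd_of_dvd_pow h1)]
  obtain ⟨b, hb, hb0⟩ := hQ.exists_fixed_point_of_prime_dvd_card_of_fixed_point (V ⧸ W) hcard
    (a := 0) (fun g => by simpa using hsmul g 0)
  obtain ⟨v, rfl⟩ := Submodule.Quotient.mk_surjective W b
  intro heq
  refine hb0 (Eq.symm ((Submodule.Quotient.mk_eq_zero W).2 ?_))
  rw [heq, mem_unipotentChain_succ]
  intro g
  have := hb g
  rw [hsmul, ← sub_eq_zero, ← Submodule.Quotient.mk_sub] at this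
  exact (Submodule.Quotient.mk_eq_zero W).1 this

/-- A product of `r` factors `σ(g) - 1` kills `V_r`. -/
theorem prod_apply_eq_zero_of_mem_unipotentChain (l : List Q) {v : V}
    (hv : v ∈ unipotentChain σ l.length) : (l.map fun g => σ g - 1).prod v = 0 := by
  induction l using List.reverseRecOn generalizing v with
  | nil => simpa [unipotentChain] using hv
  | append_singleton l g ih =>
    rw [List.length_append, List.length_singleton, mem_unipotentChain_succ] at hv
    rw [List.map_append, List.prod_append, Module.End.mul_apply]
    exact ih (by simpa using hv g)

/-- The augmentation ideal of a `p`-group acts nilpotently on a finite `p`-torsion group. -/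
theorem exists_forall_prod_map_sub_one_eq_zero [Finite V] (hQ : IsPGroup p Q) {K : ℕ}
    (hV : ∀ v : V, p ^ K • v = 0) :
    ∃ r : ℕ, ∀ l : List Q, r ≤ l.length → (l.map fun g => σ g - 1).prod = 0 := by
  obtain ⟨r, hr⟩ := WellFoundedGT.monotone_chain_condition
    ⟨unipotentChain σ, monotone_unipotentChain σ⟩
  have htop : unipotentChain σ r = ⊤ := by
    by_contra hne
    exact unipotentChain_succ_ne σ hQ hV hne (hr (r + 1) r.le_succ)
  refine ⟨r, fun l hl => ?_⟩
  ext v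
  exact prod_apply_eq_zero_of_mem_unipotentChain σ l
    (monotone_unipotentChain σ hl (htop ▸ Submodule.mem_top))

end Unipotent

/-! ### Continuous functions on the filtration -/

namespace PValuation

section LinearExtension

variable {p : ℕ} [Fact p.Prime] {H : Type*} [Group H]

/-- The additive extension of a function on `H` to the group ring of `H`. -/
noncomputable def linearExtension (φ : H → ℤ_[p]) : MonoidAlgebra ℤ H →+ ℤ_[p] :=
  MonoidAlgebra.liftNC (Int.castAddHom ℤ_[p]) φ

theorem linearExtension_of (φ : H → ℤ_[p]) (g : H) :
    linearExtension φ (MonoidAlgebra.of ℤ H g) = φ g := by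
  rw [linearExtension, MonoidAlgebra.of_apply, MonoidAlgebra.liftNC_single]
  simp

variable [TopologicalSpace H] [IsTopologicalGroup H] [CompactSpace H] {ω : PValuation p H}

/-- Uniform continuity of a continuous function on `H`, in terms of the valuation. -/
theorem exists_forall_dvd_map_mul_sub (hω : ω.DefinesTopology) {φ : H → ℤ_[p]}
    (hφ : Continuous φ) (K : ℕ) :
    ∃ ν < (⊤ : ℝ≥0∞), ∀ u, ν ≤ ω u → ∀ g, (p : ℤ_[p]) ^ K ∣ φ (g * u) - φ g := by
  have hcont : Continuous fun z : H × H => φ (z.2 * z.1) - φ z.2 := by fun_prop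
  have hball : Metric.closedBall (0 : ℤ_[p]) ((p : ℝ) ^ (-(K : ℤ))) ∈ 𝓝 (0 : ℤ_[p]) :=
    Metric.closedBall_mem_nhds _ (zpow_pos (by exact_mod_cast (Fact.out : p.Prime).pos) _)
  have hev : ∀ᶠ u in 𝓝 (1 : H), ∀ g ∈ Set.univ,
      φ (g * u) - φ g ∈ Metric.closedBall (0 : ℤ_[p]) ((p : ℝ) ^ (-(K : ℤ))) :=
    isCompact_univ.eventually_forall_of_forall_eventually fun g _ =>
      hcont.continuousAt.eventually_mem (by simpa using hball)
  obtain ⟨ν, hν, hsub⟩ := hω.mem_iff.1 hev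
  refine ⟨ν, hν, fun u hu g => ?_⟩
  have := hsub hu g trivial
  rwa [mem_closedBall_zero_iff, PadicInt.norm_le_pow_iff_mem_span_pow,
    Ideal.mem_span_singleton] at this

/-- A continuous function on `H` takes small values on the deep steps of the filtration: modulo
`p^K` it factors through a finite quotient `p`-group. -/
theorem exists_forall_dvd_linearExtension (hω : ω.DefinesTopology) {φ : H → ℤ_[p]}
    (hφ : Continuous φ) (K : ℕ) :
    ∃ N : ℕ, ∀ a ∈ ω.filtration (MonoidAlgebra.of ℤ H) N,
      (p : ℤ_[p]) ^ K ∣ linearExtension φ a := by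
  obtain ⟨ν, hν, hu⟩ := exists_forall_dvd_map_mul_sub hω hφ K
  obtain ⟨n, hn⟩ := ENNReal.exists_nat_gt hν.ne
  set U := ω.ball ν with hU
  have hUopen : IsOpen (U : Set H) := U.isOpen_of_mem_nhds (hω.mem_of_mem hν)
  have : Finite (H ⧸ U) := U.quotient_finite_of_isOpen hUopen
  have hQ : IsPGroup p (H ⧸ U) := fun x => by
    obtain ⟨g, rfl⟩ := QuotientGroup.mk_surjective x
    refine ⟨n, ?_⟩
    rw [← QuotientGroup.mk_pow, QuotientGroup.eq_one_iff, mem_ball, ω.apply_pow_p_pow]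
    exact hn.le.trans le_add_self
  have : NeZero (p ^ K) := ⟨pow_ne_zero _ (Fact.out : p.Prime).ne_zero⟩
  -- The right regular representation on functions on `H / U` with values in `ℤ / p^K`.
  let σ : H ⧸ U →* Module.End ℤ (H ⧸ U → ZMod (p ^ K)) :=
    { toFun g := LinearMap.funLeft ℤ (ZMod (p ^ K)) (· * g)
      map_one' := by ext f x; simp [LinearMap.funLeft_apply]
      map_mul' g g' := by
        refine LinearMap.ext fun f => funext fun x => ?_
        rw [Module.End.mul_apply]
        simp only [LinearMap.funLeft_apply, mul_assoc] }
  obtain ⟨r, hr⟩ := exists_forall_prod_map_sub_one_eq_zero σ hQ (K := K) fun v => by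
    ext x
    have : ((p ^ K : ℕ) : ZMod (p ^ K)) = 0 := ZMod.natCast_self _
    rw [Pi.smul_apply, nsmul_eq_mul, this, zero_mul, Pi.zero_apply]
  let φ' : H ⧸ U → ZMod (p ^ K) := fun x => PadicInt.toZModPow K (φ x.out)
  have hφ' : ∀ g : H, φ' (g : H ⧸ U) = PadicInt.toZModPow K (φ g) := fun g => by
    obtain ⟨u, hgu⟩ := QuotientGroup.mk_out_eq_mul U g
    change PadicInt.toZModPow K (φ (g : H ⧸ U).out) = _
    rw [hgu, ← sub_eq_zero, ← map_sub, ← RingHom.mem_ker, PadicInt.ker_toZModPow,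
      Ideal.mem_span_singleton]
    exact hu _ u.2 g
  let π : MonoidAlgebra ℤ H →ₐ[ℤ] Module.End ℤ (H ⧸ U → ZMod (p ^ K)) :=
    MonoidAlgebra.lift ℤ _ H (σ.comp (QuotientGroup.mk' U))
  have hπ : ∀ g, π (MonoidAlgebra.of ℤ H g) = σ g := fun g => MonoidAlgebra.lift_of _ _
  have key : ∀ a, PadicInt.toZModPow K (linearExtension φ a) = π a φ' 1 := fun a => by
    induction a using MonoidAlgebra.induction_on with
    | of g =>
      rw [hπ, linearExtension_of, ← hφ']
      change _ = φ' (1 * (g : H ⧸ U))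
      rw [one_mul]
    | add a b ha hb => simp only [map_add, ha, hb, LinearMap.add_apply, Pi.add_apply]
    | smul m a ha => simp only [map_zsmul, ha, LinearMap.smul_apply, Pi.smul_apply]
  refine ⟨K + r * n, fun a ha => ?_⟩
  rw [← Ideal.mem_span_singleton, ← PadicInt.ker_toZModPow, RingHom.mem_ker]
  have hle : ω.filtration (MonoidAlgebra.of ℤ H) ((K + r * n : ℕ) : ℝ≥0∞) ≤
      ((PadicInt.toZModPow K).toAddMonoidHom.comp (linearExtension φ)).ker := by
    refine weightedSpan_le fun k l _ hw => ?_
    change PadicInt.toZModPow K (linearExtension φ _) = 0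
    rcases le_or_gt K k with hk | hk
    · rw [← Nat.cast_pow, ← nsmul_eq_mul, map_nsmul, map_nsmul, nsmul_eq_mul]
      have : ((p ^ k : ℕ) : ZMod (p ^ K)) = 0 :=
        (ZMod.natCast_eq_zero_iff _ _).2 (pow_dvd_pow p hk)
      rw [this, zero_mul]
    · rw [key, map_mul, map_list_prod, List.map_map]
      have h0 : (l.map ((fun a => π a) ∘ fun g => MonoidAlgebra.of ℤ H g - 1)).prod = 0 := by
        have hfun : ((fun a => π a) ∘ fun g => MonoidAlgebra.of ℤ H g - 1) =
            (fun x : H ⧸ U => σ x - 1) ∘ fun g : H => (g : H ⧸ U) := by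
          funext g
          simp only [Function.comp_apply, map_sub, hπ, map_one]
        rw [hfun, ← List.map_map]
        by_cases hl : ∃ g ∈ l, g ∈ U
        · obtain ⟨g, hg, hgU⟩ := hl
          refine List.prod_eq_zero (List.mem_map.2 ⟨(g : H ⧸ U), List.mem_map.2 ⟨g, hg, rfl⟩, ?_⟩)
          rw [(QuotientGroup.eq_one_iff g).2 hgU, map_one, sub_self]
        · refine hr _ ?_
          rw [List.length_map]
          by_contra hlen
          push Not at hl hlen
          -- Otherwise the weight of the generator is too small.
          have h1 : (l.map ω).sum ≤ l.length * n := by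
            have := List.sum_le_card_nsmul (l.map ω) (n : ℝ≥0∞) (by
              intro x hx
              obtain ⟨g, hg, rfl⟩ := List.mem_map.1 hx
              exact (not_le.1 (hl g hg)).le.trans hn.le)
            simpa using this
          have h2 : ((K + r * n : ℕ) : ℝ≥0∞) ≤ ((k + l.length * n : ℕ) : ℝ≥0∞) := by
            push_cast at hw ⊢
            exact hw.trans (add_le_add_right h1 _)
          have h3 := Nat.cast_le.1 h2
          have h4 := Nat.mul_le_mul_right n hlen.le
          omega
      rw [show (l.map (⇑π ∘ fun g => MonoidAlgebra.of ℤ H g - 1)).prod = 0 from h0, mul_zero,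
        LinearMap.zero_apply, Pi.zero_apply]
  exact hle ha

end LinearExtension

end PValuation

/-! ### The coordinate functions on the filtration -/

namespace PValuation

section Gap

variable {p : ℕ} [Fact p.Prime] {x ε : ℝ≥0∞}

theorem one_le_natCast_prime : (1 : ℝ≥0∞) ≤ p := by
  exact_mod_cast (Fact.out : p.Prime).one_lt.le

theorem natCast_prime_sub_one_ne_zero : (p : ℝ≥0∞) - 1 ≠ 0 :=
  (tsub_pos_of_lt (by exact_mod_cast (Fact.out : p.Prime).one_lt)).ne'

theorem one_lt_sub_one_mul (hx : 1 / ((p : ℝ≥0∞) - 1) < x) : 1 < ((p : ℝ≥0∞) - 1) * x := by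
  rw [mul_comm]
  exact (ENNReal.div_lt_iff (Or.inl natCast_prime_sub_one_ne_zero)
    (Or.inl (ENNReal.sub_ne_top (ENNReal.natCast_ne_top p)))).1 hx

theorem add_one_add_le_mul (hx : 1 / ((p : ℝ≥0∞) - 1) < x) (hε : ε ≤ ((p : ℝ≥0∞) - 1) * x - 1) :
    x + 1 + ε ≤ p * x := by
  calc x + 1 + ε ≤ x + 1 + (((p : ℝ≥0∞) - 1) * x - 1) := by gcongr
    _ = x + (p - 1) * x := by
      rw [add_assoc, add_tsub_cancel_of_le (one_lt_sub_one_mul hx).le]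
    _ = ((p - 1) + 1) * x := by ring
    _ = p * x := by rw [tsub_add_cancel_of_le one_le_natCast_prime]

/-- A number `ε > 0` by which the weights of the nonlinear terms exceed those of the linear ones. -/
theorem exists_gap {H : Type*} [Group H] (ω : PValuation p H) {d : ℕ} (h : Fin d → H) :
    ∃ ε : ℝ≥0∞, ε ≠ 0 ∧ ε < ⊤ ∧ (∀ g, ε ≤ ω g) ∧ ∀ i, ω (h i) + 1 + ε ≤ p * ω (h i) := by
  have hpos : 0 < 1 / ((p : ℝ≥0∞) - 1) :=
    ENNReal.div_pos one_ne_zero (ENNReal.sub_ne_top (ENNReal.natCast_ne_top p))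
  have hfin : 1 / ((p : ℝ≥0∞) - 1) < ⊤ :=
    ENNReal.div_lt_top ENNReal.one_ne_top natCast_prime_sub_one_ne_zero
  refine ⟨min (1 / ((p : ℝ≥0∞) - 1))
    (Finset.univ.inf fun i => ((p : ℝ≥0∞) - 1) * ω (h i) - 1), ?_, (min_le_left _ _).trans_lt hfin,
    fun g => (min_le_left _ _).trans (ω.one_div_lt g).le, fun i => add_one_add_le_mul
      (ω.one_div_lt _) ((min_le_right _ _).trans (Finset.inf_le (Finset.mem_univ i)))⟩
  exact (lt_min hpos ((Finset.lt_inf_iff ENNReal.zero_lt_top).2 fun i _ =>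
    tsub_pos_of_lt (one_lt_sub_one_mul (ω.one_div_lt _)))).ne'

end Gap

namespace IsOrderedBasis

variable {p : ℕ} [Fact p.Prime] {H : Type*} [Group H] [TopologicalSpace H] [IsTopologicalGroup H]
  {ω : PValuation p H} {d : ℕ} {h : Fin d → H}

variable (hω : ω.DefinesTopology) (hh : ω.IsOrderedBasis h)
include hω hh

/-- The coordinate functions are dual to the ordered monomials of degree one. -/
theorem linearExtension_coord_prod_pow (i : Fin d) (γ : Fin d → ℕ) :
    linearExtension (fun g => hh.coord g i)
      (List.ofFn fun j => (MonoidAlgebra.of ℤ H (h j) - 1) ^ γ j).prod =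
        if γ = Pi.single i 1 then 1 else 0 := by
  induction γ using WellFoundedLT.induction with
  | ind γ ih =>
  have hexp := congrArg (linearExtension fun g => hh.coord g i)
    (map_prod_ofFn_pow (MonoidAlgebra.of ℤ H) h γ)
  rw [linearExtension_of, ← orderedProd_natCast hω hh, hh.coord_orderedProd, map_sum] at hexp
  set S := Fintype.piFinset fun j => Finset.range (γ j + 1) with hS
  have hmem : ∀ γ', γ' ∈ S ↔ γ' ≤ γ := fun γ' => by
    simp [hS, Fintype.mem_piFinset, Pi.le_def]
  have hγ : γ ∈ S := (hmem γ).2 le_rfl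
  rw [← Finset.add_sum_erase S _ hγ] at hexp
  have hrest : ∑ γ' ∈ S.erase γ, linearExtension (fun g => hh.coord g i)
      ((∏ j, (γ j).choose (γ' j)) •
        (List.ofFn fun j => (MonoidAlgebra.of ℤ H (h j) - 1) ^ γ' j).prod) =
      ∑ γ' ∈ S.erase γ, if γ' = Pi.single i 1 then (γ i : ℤ_[p]) else 0 := by
    refine Finset.sum_congr rfl fun γ' hγ' => ?_
    rw [Finset.mem_erase, hmem] at hγ'
    rw [map_nsmul, ih γ' (lt_of_le_of_ne hγ'.2 hγ'.1)]
    split_ifs with heq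
    · subst heq
      rw [Finset.prod_eq_single i (fun j _ hj => by simp [hj]) (by simp)]
      simp
    · simp
  rw [hrest, Finset.sum_ite_eq'] at hexp
  simp only [Nat.choose_self, Finset.prod_const_one, one_smul, Finset.mem_erase, hmem] at hexp
  rcases eq_or_ne γ (Pi.single i 1) with rfl | hne
  · simpa using hexp.symm
  · rw [if_neg hne]
    by_cases hle : Pi.single i 1 ≤ γ
    · simpa [hle, Ne.symm hne, hmem] using hexp
    · have hi : γ i = 0 := by
        by_contra hi
        refine hle fun j => ?_
        rcases eq_or_ne j i with rfl | hj
        · simpa using Nat.one_le_iff_ne_zero.2 hi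
        · simp [hj]
      simpa [hle, hi, eq_comm] using hexp

/-- The coordinate functions respect the filtration: the `i`-th coordinate of an element of weight
`ν` has valuation at least `ν - ω(h_i)`. -/
theorem le_emultiplicity_add (i : Fin d) {ν : ℝ≥0∞} (hν : ν < ⊤) {a : MonoidAlgebra ℤ H}
    (ha : a ∈ ω.filtration (MonoidAlgebra.of ℤ H) ν) :
    ν ≤ ((emultiplicity (p : ℤ_[p]) (linearExtension (fun g => hh.coord g i) a) : ℕ∞) : ℝ≥0∞) +
      ω (h i) := by
  obtain ⟨ε, hε₀, hε', hε, hb⟩ := exists_gap ω h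
  obtain ⟨K, hK⟩ := ENNReal.exists_nat_gt hν.ne
  have := hh.compactSpace
  obtain ⟨N, hN⟩ := exists_forall_dvd_linearExtension hω (φ := fun g => hh.coord g i)
    ((continuous_apply i).comp hh.continuous_coord) K
  let S : AddSubgroup (MonoidAlgebra ℤ H) :=
    { carrier := {a | ν ≤ ((emultiplicity (p : ℤ_[p])
        (linearExtension (fun g => hh.coord g i) a) : ℕ∞) : ℝ≥0∞) + ω (h i)}
      zero_mem' := by simp
      neg_mem' := fun {a} ha => by simpa [emultiplicity_neg] using ha
      add_mem' := fun {a b} ha hb => by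
        change ν ≤ _ + _
        rw [map_add]
        rcases min_le_iff.1 (min_le_emultiplicity_add (p := (p : ℤ_[p]))
          (a := linearExtension (fun g => hh.coord g i) a)
          (b := linearExtension (fun g => hh.coord g i) b)) with hle | hle
        · exact ha.trans (add_le_add_left (ENat.toENNReal_le.2 hle) _)
        · exact hb.trans (add_le_add_left (ENat.toENNReal_le.2 hle) _) }
  have h1 : ω.filtration (MonoidAlgebra.of ℤ H) N ≤ S := fun b hb => by
    refine hK.le.trans (le_trans ?_ le_self_add)
    have := ENat.toENNReal_le.2 (le_emultiplicity_of_pow_dvd (hN b hb))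
    simpa using this
  have h2 : weightedSpan p (fun i => MonoidAlgebra.of ℤ H (h i) - 1) (fun i => ω (h i))
      (Set.range orderedList) ν ≤ S := by
    refine weightedSpan_le ?_
    rintro k _ ⟨γ, rfl⟩ hw
    change ν ≤ _
    rw [← Nat.cast_pow, ← nsmul_eq_mul, map_nsmul, prod_map_orderedList,
      linearExtension_coord_prod_pow hω hh]
    split_ifs with hγ
    · subst hγ
      rw [sum_map_orderedList, Finset.sum_eq_single i (fun j _ hj => by simp [hj]) (by simp),
        Pi.single_eq_same, one_smul] at hw
      refine hw.trans (add_le_add_left ?_ _)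
      have := ENat.toENNReal_le.2 (le_emultiplicity_of_pow_dvd
        (show (p : ℤ_[p]) ^ k ∣ (p ^ k : ℕ) • (1 : ℤ_[p]) by simp))
      simpa using this
    · simp
  exact (sup_le h2 h1)
    (filtration_le_sup_natCast hω hh (MonoidAlgebra.of ℤ H) hε₀ hε' hε hb ν N ha)

theorem coord_one : hh.coord 1 = 0 := by
  have h1 := orderedProd_natCast hω hh 0
  simp only [Pi.zero_apply, Nat.cast_zero, pow_zero, List.ofFn_const, List.prod_replicate,
    one_pow] at h1
  rw [← h1, hh.coord_orderedProd]
  rfl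

theorem coord_basis (i : Fin d) : hh.coord (h i) i = 1 := by
  have h1 := orderedProd_natCast hω hh (Pi.single i 1)
  have h2 : (List.ofFn fun j => h j ^ (Pi.single i 1 : Fin d → ℕ) j).prod = h i := by
    have h3 := prod_map_orderedList (Pi.single i 1) h
    have h4 : orderedList (Pi.single i 1) = [i] := by
      have h5 := orderedList_count_perm [i]
      have h6 : (fun j => List.count j [i]) = Pi.single i 1 := by
        funext j
        rcases eq_or_ne j i with rfl | hj
        · simp
        · simp [hj, Ne.symm hj]
      rw [h6] at h5
      exact List.perm_singleton.1 h5
    rw [← h3, h4]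
    simp
  rw [h2] at h1
  conv_lhs => rw [← h1]
  rw [hh.coord_orderedProd]
  simp

/-- In a saturated group, the valuation of a basis element is at most `p / (p - 1)`: a basis
element is not a `p`-th power, since the `i`-th coordinate of `g^p` is divisible by `p` up to terms
of higher order. -/
theorem apply_basis_le (hsat : ω.IsSaturated) (i : Fin d) :
    ω (h i) ≤ (p : ℝ≥0∞) / ((p : ℝ≥0∞) - 1) := by
  by_contra hlt
  obtain ⟨g, hg⟩ := hsat (h i) (not_le.1 hlt)
  have hωi : ω (h i) = ω g + 1 := by rw [← hg, ω.pow_p]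
  have htop : ω (h i) ≠ ⊤ := fun hc => by
    have h1 := coord_basis hω hh i
    rw [(ω.eq_top_iff _).1 hc, coord_one hω hh] at h1
    exact zero_ne_one h1
  have hgap := one_lt_sub_one_mul (ω.one_div_lt g)
  set ε := min (ω g) (((p : ℝ≥0∞) - 1) * ω g - 1) with hε
  have hε0 : 0 < ε := lt_min (zero_le.trans_lt (ω.one_div_lt g)) (tsub_pos_of_lt hgap)
  have hmem := add_one_pow_sub_mem_filtration (ρ := MonoidAlgebra.of ℤ H) (Fact.out : p.Prime)
    (map_sub_one_mem_filtration ω _ g) (min_le_left _ _ : ε ≤ ω g)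
    (add_one_add_le_mul (ω.one_div_lt g) (min_le_right _ _))
  rw [sub_add_cancel, ← map_pow, hg, ← hωi] at hmem
  have hle := le_emultiplicity_add hω hh i (ENNReal.add_lt_top.2 ⟨htop.lt_top,
    (min_le_left _ _).trans_lt (lt_top_iff_ne_top.2 fun hc => htop (by rw [hωi, hc, top_add]))⟩)
    hmem
  rw [add_comm, ENNReal.add_le_add_iff_right htop] at hle
  have hdvd : (p : ℤ_[p]) ∣ linearExtension (fun g => hh.coord g i) (MonoidAlgebra.of ℤ H (h i) -
      1 - p * (MonoidAlgebra.of ℤ H g - 1)) := by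
    refine emultiplicity_ne_zero.1 fun h0 => ?_
    rw [h0] at hle
    simp only [ENat.toENNReal_zero, nonpos_iff_eq_zero] at hle
    exact hε0.ne' hle
  rw [← nsmul_eq_mul, map_sub, map_sub, map_nsmul, linearExtension_of, coord_basis hω hh,
    nsmul_eq_mul, dvd_sub_left (dvd_mul_right _ _), ← map_one (MonoidAlgebra.of ℤ H),
    linearExtension_of, coord_one hω hh, Pi.zero_apply, sub_zero] at hdvd
  exact PadicInt.p_nonunit (isUnit_of_dvd_one hdvd)

end IsOrderedBasis

end PValuation

/-! ### Analyticity of the coordinates -/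

namespace TateAlgebra

variable {p : ℕ} [Fact p.Prime] {σ : Type} [Fintype σ]

/-- A series on the closed ball is a continuous function on `ℤ_p^σ`, as a uniform limit of
polynomials. -/
theorem continuous_point (f : TateAlgebra p σ) :
    Continuous fun x : σ → ℤ_[p] => point x f := by
  refine continuous_of_uniform_approx_of_continuous fun u hu => ?_
  obtain ⟨ε, hε, hu⟩ := Metric.mem_uniformity_dist.1 hu
  obtain ⟨s, hs⟩ := ((hasSum_coeff_smul_prod_X_pow f).eventually
    (Metric.ball_mem_nhds f hε)).exists
  refine ⟨fun x => point x (∑ I ∈ s, coeff I f • ∏ i, (X i : TateAlgebra p σ) ^ I i), ?_,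
    fun x => hu ?_⟩
  · simp only [map_sum, map_smul, map_prod, map_pow, point_X]
    fun_prop
  · rw [dist_eq_norm, ← map_sub]
    refine (AlgHom.norm_apply_le_self (point x).toAlgHom _).trans_lt ?_
    rw [← dist_eq_norm, dist_comm]
    exact hs

end TateAlgebra

section Factorial

variable {p : ℕ} [Fact p.Prime]

theorem tendsto_sum_cofinite_atTop {σ : Type*} [Fintype σ] :
    Tendsto (fun γ : σ → ℕ => ∑ j, γ j) cofinite atTop := by
  refine tendsto_atTop.2 fun N => eventually_cofinite.2
    ((Set.Finite.pi' fun _ : σ => Set.finite_Iic N).subset fun γ hγ j => ?_)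
  exact (Finset.single_le_sum (f := γ) (fun _ _ => Nat.zero_le _) (Finset.mem_univ j)).trans
    (not_le.1 hγ).le

theorem zpow_neg_le_norm_prod_factorial {σ : Type*} [Fintype σ] (γ : σ → ℕ) :
    (p : ℝ) ^ (-(padicValNat p (∑ j, γ j).factorial : ℤ)) ≤ ‖∏ j, ((γ j).factorial : ℚ_[p])‖ := by
  obtain ⟨q, hq⟩ := Nat.prod_factorial_dvd_factorial_sum Finset.univ γ
  have h1 : ‖((∑ j, γ j).factorial : ℚ_[p])‖ =
      (p : ℝ) ^ (-(padicValNat p (∑ j, γ j).factorial : ℤ)) := by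
    rw [Padic.norm_eq_zpow_neg_valuation (Nat.cast_ne_zero.2 (Nat.factorial_ne_zero _)),
      Padic.valuation_natCast]
  rw [← h1, hq, Nat.cast_mul, norm_mul, Nat.cast_prod]
  exact mul_le_of_le_one_right (norm_nonneg _) (IsUltrametricDist.norm_natCast_le_one ℚ_[p] q)

/-- The estimate on Mahler coefficients: if `v(c) ≥ n δ - W` with `n = |γ|`,
`δ = 1 / (p - 1) + η` and `W ≤ 1 + 1 / (p - 1)`, then `v(c / γ!) ≥ n η - 1`, by Legendre's bound
`(p - 1) v(n!) ≤ n - 1`. -/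
theorem norm_div_prod_factorial_le {σ : Type*} [Fintype σ] {γ : σ → ℕ} {c : ℤ_[p]} {W η : ℝ}
    (hW : W ≤ 1 + 1 / ((p : ℝ) - 1))
    (hγ : γ ≠ 0) (hc : ∀ k : ℕ, ¬ (p : ℤ_[p]) ^ (k + 1) ∣ c →
      (∑ j, γ j : ℕ) * (1 / ((p : ℝ) - 1) + η) ≤ k + W) :
    ∃ e : ℤ, ((∑ j, γ j : ℕ) * η - 1 ≤ e) ∧
      ‖(c : ℚ_[p]) / ∏ j, ((γ j).factorial : ℚ_[p])‖ ≤ (p : ℝ) ^ (-e) := by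
  have hp : p.Prime := Fact.out
  have hp0 : (0 : ℝ) < p := by exact_mod_cast hp.pos
  have hq : (0 : ℝ) < (p : ℝ) - 1 := sub_pos.2 (by exact_mod_cast hp.one_lt)
  set n := ∑ j, γ j with hn
  have hn0 : n ≠ 0 := fun h0 => hγ (funext fun j => by
    simpa using (Finset.sum_eq_zero_iff.1 h0) j (Finset.mem_univ j))
  rcases eq_or_ne c 0 with rfl | hc0
  · exact ⟨⌈n * η - 1⌉, Int.le_ceil _, by simpa using (zpow_pos hp0 _).le⟩
  have hfin : FiniteMultiplicity (p : ℤ_[p]) c :=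
    FiniteMultiplicity.of_not_isUnit PadicInt.p_nonunit hc0
  set k := multiplicity (p : ℤ_[p]) c with hk
  set v := padicValNat p n.factorial with hv
  have hkW := hc k (hfin.not_pow_dvd_of_multiplicity_lt k.lt_succ_self)
  have hleg : ((p : ℝ) - 1) * v + 1 ≤ n := by
    have := sub_one_mul_padicValNat_factorial_lt_of_ne_zero p hn0
    have h2 : (p - 1) * v + 1 ≤ n := this
    have h3 : (((p - 1 : ℕ) * v + 1 : ℕ) : ℝ) ≤ n := by exact_mod_cast h2
    rwa [Nat.cast_add, Nat.cast_mul, Nat.cast_sub hp.one_lt.le, Nat.cast_one] at h3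
  refine ⟨(k : ℤ) - v, ?_, ?_⟩
  · have h1 : (v : ℝ) ≤ (n - 1) * (1 / ((p : ℝ) - 1)) := by
      rw [mul_one_div, le_div_iff₀ hq]
      linarith
    push_cast
    nlinarith
  · rw [norm_div]
    have hck : ‖(c : ℚ_[p])‖ ≤ (p : ℝ) ^ (-(k : ℤ)) := by
      have := (PadicInt.norm_le_pow_iff_mem_span_pow c k).2
        (Ideal.mem_span_singleton.2 (pow_multiplicity_dvd _ _))
      simpa using this
    calc _ ≤ (p : ℝ) ^ (-(k : ℤ)) / (p : ℝ) ^ (-(v : ℤ)) :=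
          div_le_div₀ (zpow_nonneg hp0.le _) hck (zpow_pos hp0 _)
            (zpow_neg_le_norm_prod_factorial γ)
      _ = _ := by
        rw [← zpow_sub₀ hp0.ne']
        congr 1
        ring

end Factorial

namespace PValuation

namespace IsOrderedBasis

variable {p : ℕ} [Fact p.Prime] {H : Type*} [Group H] [TopologicalSpace H] [IsTopologicalGroup H]
  {ω : PValuation p H} {d : ℕ} {h : Fin d → H}
  (hω : ω.DefinesTopology) (hh : ω.IsOrderedBasis h)
include hω hh

omit [TopologicalSpace H] [IsTopologicalGroup H] hω hh [Fact p.Prime] in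
theorem prod_ofFn_pow_mem_filtration {A : Type*} [Ring A] (ρ : H →* A) {m : ℕ} (g : Fin m → H)
    (γ : Fin m → ℕ) {δ : ℝ≥0∞} (hδ : ∀ j, δ ≤ ω (g j)) :
    (List.ofFn fun j => (ρ (g j) - 1) ^ γ j).prod ∈
      ω.filtration ρ ((∑ j, γ j : ℕ) * δ) := by
  rw [← prod_map_orderedList γ fun j => ρ (g j) - 1]
  have h1 := pow_mul_prod_mem_weightedSpan (p := p) (z := fun g => ρ g - 1) (w := ω)
    (P := Set.univ) (l := (orderedList γ).map g) (k := 0) (ν := (∑ j, γ j : ℕ) * δ) trivial (by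
      rw [List.map_map, sum_map_orderedList, Nat.cast_zero, zero_add, Nat.cast_sum,
        Finset.sum_mul]
      refine Finset.sum_le_sum fun j _ => ?_
      rw [nsmul_eq_mul]
      exact mul_le_mul_right (hδ j) _)
  simpa [filtration, Function.comp_def] using h1

/-- A continuous map to a saturated group given by `n ↦ g_1^{n_1} ⋯ g_m^{n_m}` on natural numbers
has coordinates given by series in the Tate algebra of Gauss norm at most one. -/
theorem exists_tateAlgebra_point_eq_coord (hsat : ω.IsSaturated) {m : ℕ} (g : Fin m → H)
    {F : (Fin m → ℤ_[p]) → H} (hF : Continuous F)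
    (hFn : ∀ n : Fin m → ℕ, F (fun j => n j) = (List.ofFn fun j => g j ^ n j).prod) (i : Fin d) :
    ∃ f : TateAlgebra p (Fin m), ‖f‖ ≤ 1 ∧
      ∀ x, TateAlgebra.point x f = (hh.coord (F x) i : ℚ_[p]) := by
  have hp : p.Prime := Fact.out
  have hp1 : (1 : ℝ) < p := by exact_mod_cast hp.one_lt
  have hq : (0 : ℝ) < (p : ℝ) - 1 := sub_pos.2 hp1
  have hsub : ((p : ℝ≥0∞) - 1) = ENNReal.ofReal ((p : ℝ) - 1) := by
    rw [ENNReal.ofReal_sub _ zero_le_one, ENNReal.ofReal_natCast, ENNReal.ofReal_one]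
  have hone : 1 / ((p : ℝ≥0∞) - 1) = ENNReal.ofReal (1 / ((p : ℝ) - 1)) := by
    rw [hsub, ENNReal.ofReal_div_of_pos hq, ENNReal.ofReal_one]
  -- A uniform lower bound `1 / (p - 1) + η` for the valuations of the `g_j`.
  obtain ⟨η, hη, hgη⟩ : ∃ η : ℝ, 0 < η ∧
      ∀ j, ENNReal.ofReal (1 / ((p : ℝ) - 1) + η) ≤ ω (g j) := by
    have hlt : 1 / ((p : ℝ≥0∞) - 1) < Finset.univ.inf fun j => ω (g j) :=
      (Finset.lt_inf_iff (hone ▸ ENNReal.ofReal_lt_top)).2 fun j _ => ω.one_div_lt _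
    obtain ⟨δ, hδ1, hδ2⟩ := exists_between hlt
    have hδtop : δ ≠ ⊤ := (hδ2.trans_le le_top).ne
    refine ⟨δ.toReal - 1 / ((p : ℝ) - 1), ?_, fun j => ?_⟩
    · rw [hone] at hδ1
      exact sub_pos.2 ((ENNReal.ofReal_lt_iff_lt_toReal (by positivity) hδtop).1 hδ1)
    · rw [add_sub_cancel, ENNReal.ofReal_toReal hδtop]
      exact hδ2.le.trans (Finset.inf_le (Finset.mem_univ j))
  have hωi := apply_basis_le hω hh hsat i
  have hWfin : (p : ℝ≥0∞) / ((p : ℝ≥0∞) - 1) ≠ ⊤ :=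
    (ENNReal.div_lt_top (ENNReal.natCast_ne_top p) natCast_prime_sub_one_ne_zero).ne
  have hW : (ω (h i)).toReal ≤ 1 + 1 / ((p : ℝ) - 1) := by
    refine (ENNReal.toReal_mono hWfin hωi).trans_eq ?_
    rw [ENNReal.toReal_div, hsub, ENNReal.toReal_natCast, ENNReal.toReal_ofReal hq.le]
    field_simp
    ring
  set c : (Fin m → ℕ) → ℤ_[p] := fun γ => linearExtension (fun g => hh.coord g i)
    (List.ofFn fun j => (MonoidAlgebra.of ℤ H (g j) - 1) ^ γ j).prod with hc
  have hest : ∀ γ : Fin m → ℕ, γ ≠ 0 → ∃ e : ℤ, ((∑ j, γ j : ℕ) * η - 1 ≤ e) ∧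
      ‖(c γ : ℚ_[p]) / ∏ j, ((γ j).factorial : ℚ_[p])‖ ≤ (p : ℝ) ^ (-e) := fun γ hγ => by
    refine norm_div_prod_factorial_le hW hγ fun k hk => ?_
    have h1 := le_emultiplicity_add hω hh i
      (ENNReal.mul_lt_top (ENNReal.natCast_lt_top _) ENNReal.ofReal_lt_top)
      (prod_ofFn_pow_mem_filtration (MonoidAlgebra.of ℤ H) g γ hgη)
    have h2 : ((emultiplicity (p : ℤ_[p]) (c γ) : ℕ∞) : ℝ≥0∞) ≤ (k : ℕ) := by
      have := ENat.toENNReal_le.2 (Order.le_of_lt_add_one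
        (by exact_mod_cast emultiplicity_lt_iff_not_dvd.2 hk :
          emultiplicity (p : ℤ_[p]) (c γ) < (k : ℕ∞) + 1))
      simpa using this
    have h3 := h1.trans (add_le_add_left h2 _)
    have h4 := ENNReal.toReal_mono (ENNReal.add_ne_top.2
      ⟨ENNReal.natCast_ne_top k, ne_top_of_le_ne_top hWfin hωi⟩) h3
    rwa [ENNReal.toReal_mul, ENNReal.toReal_ofReal (by positivity), ENNReal.toReal_natCast,
      ENNReal.toReal_add (ENNReal.natCast_ne_top k) (ne_top_of_le_ne_top hWfin hωi),
      ENNReal.toReal_natCast] at h4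
  have hzero : ‖(c 0 : ℚ_[p]) / ∏ j : Fin m, (((0 : Fin m → ℕ) j).factorial : ℚ_[p])‖ ≤ 1 := by
    simpa using (c 0).norm_le_one
  obtain ⟨f, hf1, hf⟩ := TateAlgebra.exists_forall_point_eq_sum_choose
    (fun γ => (c γ : ℚ_[p])) (by
      refine squeeze_zero_norm (a := fun γ => (p : ℝ) ^ (-((∑ j, γ j : ℕ) * η - 1)))
        (fun γ => ?_) ?_
      · rcases eq_or_ne γ 0 with rfl | hγ
        · refine hzero.trans ?_
          simpa using hp1.le
        · obtain ⟨e, he, hle⟩ := hest γ hγ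
          refine hle.trans ?_
          rw [← Real.rpow_intCast]
          refine Real.rpow_le_rpow_of_exponent_le hp1.le ?_
          push_cast at he ⊢
          linarith
      · have h1 : Tendsto (fun γ : Fin m → ℕ => ((∑ j, γ j : ℕ) : ℝ) * η - 1) cofinite atTop :=
          tendsto_atTop_add_const_right _ _ ((tendsto_natCast_atTop_atTop.comp
            tendsto_sum_cofinite_atTop).atTop_mul_const hη)
        have h2 := (tendsto_rpow_atBot_of_base_gt_one (p : ℝ) hp1).comp
          (tendsto_neg_atTop_atBot.comp h1)
        exact h2)
    (fun γ => by
      rcases eq_or_ne γ 0 with rfl | hγ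
      · exact hzero
      · obtain ⟨e, he, hle⟩ := hest γ hγ
        refine hle.trans ?_
        -- Here saturation enters: the exponent `e` is an integer exceeding `-1`.
        have hn : 0 < ∑ j, γ j := Nat.pos_of_ne_zero fun h0 => hγ (funext fun j => by
          simpa using (Finset.sum_eq_zero_iff.1 h0) j (Finset.mem_univ j))
        have h1 : (-1 : ℝ) < e := by
          have : (0 : ℝ) < (∑ j, γ j : ℕ) * η := mul_pos (by exact_mod_cast hn) hη
          linarith
        have h2 : (-1 : ℤ) < e := by exact_mod_cast h1
        exact zpow_le_one_of_nonpos₀ hp1.le (by omega))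
  refine ⟨f, hf1, ?_⟩
  have hdense : DenseRange fun (n : Fin m → ℕ) (j : Fin m) => (n j : ℤ_[p]) :=
    DenseRange.piMap fun _ => PadicInt.denseRange_natCast
  have hcont : Continuous fun x => (hh.coord (F x) i : ℚ_[p]) :=
    continuous_subtype_val.comp ((continuous_apply i).comp (hh.continuous_coord.comp hF))
  refine congrFun (hdense.equalizer (TateAlgebra.continuous_point f) hcont (funext fun n => ?_))
  have hexp := congrArg (linearExtension fun g => hh.coord g i)
    (map_prod_ofFn_pow (MonoidAlgebra.of ℤ H) g n)
  rw [linearExtension_of, ← hFn, map_sum] at hexp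
  simp only [Function.comp_apply]
  rw [hf, hexp, PadicInt.coe_sum]
  refine Finset.sum_congr rfl fun γ _ => ?_
  rw [map_nsmul, nsmul_eq_mul, PadicInt.coe_mul, PadicInt.coe_natCast, Nat.cast_prod, mul_comm]

end IsOrderedBasis

end PValuation

/-! ### Morphisms assembled from coordinates -/

namespace TateAlgebra

variable {p : ℕ} [Fact p.Prime] {σ τ : Type} [Fintype τ] {A : Type*} [NormedCommRing A]
  [NormedAlgebra ℚ_[p] A] [CompleteSpace A] [IsUltrametricDist A]

/-- The morphism into a closed ball whose `t`-th coordinate is the `k(t)`-th coordinate of the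
morphism `φ_t`. -/
noncomputable def gather (φ : τ → TateAlgebra p σ →A[ℚ_[p]] A) (k : τ → σ) :
    TateAlgebra p τ →A[ℚ_[p]] A :=
  eval (fun t => φ t (X (k t)))
    (exists_norm_prod_pow_le fun t => exists_norm_map_pow_le (φ t) (norm_X_le (k t)))

@[simp] theorem gather_X (φ : τ → TateAlgebra p σ →A[ℚ_[p]] A) (k : τ → σ) (t : τ) :
    gather φ k (X t) = φ t (X (k t)) := eval_X _ _ t

theorem comp_gather {A' : Type*} [NormedCommRing A'] [NormedAlgebra ℚ_[p] A'] [CompleteSpace A']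
    [IsUltrametricDist A'] (f : A →A[ℚ_[p]] A') (φ : τ → TateAlgebra p σ →A[ℚ_[p]] A)
    (k : τ → σ) : f.comp (gather φ k) = gather (fun t => f.comp (φ t)) k :=
  continuousAlgHom_ext fun t => by simp

/-- The morphism between closed balls given by a tuple of series of Gauss norm at most one. -/
noncomputable def ofSeries (f : τ → TateAlgebra p σ) (hf : ∀ t, ‖f t‖ ≤ 1) :
    TateAlgebra p τ →A[ℚ_[p]] TateAlgebra p σ :=
  eval f (exists_norm_prod_pow_le fun t =>
    exists_norm_map_pow_le (ContinuousAlgHom.id ℚ_[p] _) (hf t))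

@[simp] theorem ofSeries_X (f : τ → TateAlgebra p σ) (hf : ∀ t, ‖f t‖ ≤ 1) (t : τ) :
    ofSeries f hf (X t) = f t := eval_X _ _ t

/-- The constant morphism with value the origin of the closed ball. -/
noncomputable def origin : TateAlgebra p τ →A[ℚ_[p]] A :=
  eval (fun _ => 0) (exists_norm_prod_pow_le fun _ => ⟨‖(1 : A)‖, fun n => by
    rcases n with _ | n <;> simp⟩)

@[simp] theorem origin_X (t : τ) : (origin : TateAlgebra p τ →A[ℚ_[p]] A) (X t) = 0 := eval_X _ _ t

/-- Finitely many `A`-points of a closed ball are the images of universal points under a single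
homomorphism from a Tate algebra. -/
theorem exists_comp_eq {κ : Type} [Fintype κ] (x : κ → TateAlgebra p τ →A[ℚ_[p]] A) :
    ∃ (f : TateAlgebra p (κ × τ) →A[ℚ_[p]] A)
      (u : κ → TateAlgebra p τ →A[ℚ_[p]] TateAlgebra p (κ × τ)), ∀ j, f.comp (u j) = x j :=
  ⟨gather (fun t => x t.1) Prod.snd,
    fun j => gather (fun _ => ContinuousAlgHom.id ℚ_[p] _) (fun t => (j, t)),
    fun j => continuousAlgHom_ext fun t => by simp⟩

variable {d : ℕ}

/-- The point of the product of two closed balls given by a pair of points. -/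
noncomputable def pair (x y : TateAlgebra p (Fin d) →A[ℚ_[p]] A) :
    TateAlgebra p (Fin (d + d)) →A[ℚ_[p]] A :=
  gather (Fin.append (fun _ => x) (fun _ => y)) (Fin.append id id)

@[simp] theorem pair_X_castAdd (x y : TateAlgebra p (Fin d) →A[ℚ_[p]] A) (i : Fin d) :
    pair x y (X (Fin.castAdd d i)) = x (X i) := by simp [pair]

@[simp] theorem pair_X_natAdd (x y : TateAlgebra p (Fin d) →A[ℚ_[p]] A) (i : Fin d) :
    pair x y (X (Fin.natAdd d i)) = y (X i) := by
  simp [pair, -Fin.natAdd_eq_addNat]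

theorem comp_pair {A' : Type*} [NormedCommRing A'] [NormedAlgebra ℚ_[p] A'] [CompleteSpace A']
    [IsUltrametricDist A'] (f : A →A[ℚ_[p]] A') (x y : TateAlgebra p (Fin d) →A[ℚ_[p]] A) :
    f.comp (pair x y) = pair (f.comp x) (f.comp y) :=
  continuousAlgHom_ext fun t => by
    induction t using Fin.addCases <;> simp [-Fin.natAdd_eq_addNat]

omit [Fintype τ] in
theorem coe_pointCoord (φ : TateAlgebra p τ →ₐ[ℚ_[p]] ℚ_[p]) (t : τ) :
    (pointCoord φ t : ℚ_[p]) = φ (X t) := rfl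

theorem eq_point_pointCoord (φ : TateAlgebra p τ →A[ℚ_[p]] ℚ_[p]) :
    φ = point (pointCoord φ.toAlgHom) :=
  continuousAlgHom_ext fun t => by rw [point_X, coe_pointCoord]; rfl

theorem pointCoord_point (a : τ → ℤ_[p]) : pointCoord (point a).toAlgHom = a :=
  funext fun t => Subtype.ext ((coe_pointCoord _ t).trans (point_X a t))

end TateAlgebra

/-! ### The group law -/

namespace PValuation

namespace IsOrderedBasis

open TateAlgebra

variable {p : ℕ} [Fact p.Prime] {H : Type*} [Group H] [TopologicalSpace H] [IsTopologicalGroup H]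
  {ω : PValuation p H} {d : ℕ} {h : Fin d → H}

section Laws

variable (hω : ω.DefinesTopology) (hsat : ω.IsSaturated) (hh : ω.IsOrderedBasis h)
include hω hsat hh

/-- Multiplication is given in coordinates by integral series in the Tate algebra. -/
theorem exists_mulSeries : ∃ f : Fin d → TateAlgebra p (Fin (d + d)), (∀ i, ‖f i‖ ≤ 1) ∧
    ∀ x y : Fin d → ℤ_[p], ∀ i, point (Fin.append x y) (f i) =
      (hh.coord (orderedProd h x * orderedProd h y) i : ℚ_[p]) := by
  have hc : Continuous (orderedProd h) := hh.isHomeomorph.continuous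
  have key := exists_tateAlgebra_point_eq_coord hω hh hsat (Fin.append h h)
    (F := fun z => orderedProd h (fun i => z (Fin.castAdd d i)) *
      orderedProd h (fun i => z (Fin.natAdd d i)))
    ((hc.comp (by fun_prop)).mul (hc.comp (by fun_prop))) (fun n => by
      rw [orderedProd_natCast hω hh fun i => n (Fin.castAdd d i),
        orderedProd_natCast hω hh fun i => n (Fin.natAdd d i), ← List.prod_append,
        ← List.ofFn_fin_append]
      congr 2
      funext j
      induction j using Fin.addCases <;> simp [-Fin.natAdd_eq_addNat])
  choose f hf1 hf using key
  exact ⟨f, hf1, fun x y i => by simp [hf i, -Fin.natAdd_eq_addNat]⟩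

/-- Inversion is given in coordinates by integral series in the Tate algebra. The order of the
variables is reversed, since `(∏ h_i^{x_i})⁻¹` is the product of the `h_i^{-x_i}` in the opposite
order. -/
theorem exists_invSeries : ∃ f : Fin d → TateAlgebra p (Fin d), (∀ i, ‖f i‖ ≤ 1) ∧
    ∀ x : Fin d → ℤ_[p], ∀ i, point (fun j => x j.rev) (f i) =
      (hh.coord (orderedProd h x)⁻¹ i : ℚ_[p]) := by
  have hc : Continuous (orderedProd h) := hh.isHomeomorph.continuous
  have key := exists_tateAlgebra_point_eq_coord hω hh hsat (fun j => (h j.rev)⁻¹)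
    (F := fun z => (orderedProd h fun i => z i.rev)⁻¹)
    ((hc.comp (by fun_prop)).inv) (fun n => by
      rw [orderedProd_natCast hω hh fun i => n i.rev, List.prod_inv_reverse, List.map_ofFn]
      congr 1
      refine List.ext_getElem (by simp) fun k h1 h2 => ?_
      have hk : k < d := by simpa using h1
      have : (⟨d - 1 - k, by omega⟩ : Fin d) = Fin.rev ⟨k, hk⟩ := by
        ext
        simp only [Fin.val_rev]
        omega
      simp [this])
  choose f hf1 hf using key
  exact ⟨f, hf1, fun x i => by simp [hf i]⟩

/-- The comultiplication. -/
noncomputable def comul : TateAlgebra p (Fin d) →A[ℚ_[p]] TateAlgebra p (Fin (d + d)) :=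
  ofSeries _ (exists_mulSeries hω hsat hh).choose_spec.1

/-- The antipode, with the order of the variables reversed. -/
noncomputable def antipode : TateAlgebra p (Fin d) →A[ℚ_[p]] TateAlgebra p (Fin d) :=
  ofSeries _ (exists_invSeries hω hsat hh).choose_spec.1

section

variable {A : Type*} [NormedCommRing A] [NormedAlgebra ℚ_[p] A] [CompleteSpace A]
  [IsUltrametricDist A]

/-- The product of two `A`-points. -/
noncomputable def mulPoint (x y : TateAlgebra p (Fin d) →A[ℚ_[p]] A) :
    TateAlgebra p (Fin d) →A[ℚ_[p]] A :=
  (pair x y).comp (comul hω hsat hh)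

/-- The inverse of an `A`-point. -/
noncomputable def invPoint (x : TateAlgebra p (Fin d) →A[ℚ_[p]] A) :
    TateAlgebra p (Fin d) →A[ℚ_[p]] A :=
  (gather (fun _ => x) Fin.rev).comp (antipode hω hsat hh)

variable {A' : Type*} [NormedCommRing A'] [NormedAlgebra ℚ_[p] A'] [CompleteSpace A']
  [IsUltrametricDist A'] (f : A →A[ℚ_[p]] A')

theorem comp_mulPoint (x y : TateAlgebra p (Fin d) →A[ℚ_[p]] A) :
    f.comp (mulPoint hω hsat hh x y) = mulPoint hω hsat hh (f.comp x) (f.comp y) := by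
  rw [mulPoint, mulPoint, ← ContinuousAlgHom.comp_assoc, comp_pair]

theorem comp_invPoint (x : TateAlgebra p (Fin d) →A[ℚ_[p]] A) :
    f.comp (invPoint hω hsat hh x) = invPoint hω hsat hh (f.comp x) := by
  rw [invPoint, invPoint, ← ContinuousAlgHom.comp_assoc, comp_gather]

end

omit hω hsat hh in
variable (h) in
/-- The element of `H` defined by a `ℚ_p`-point. -/
noncomputable def ofPoint (φ : TateAlgebra p (Fin d) →A[ℚ_[p]] ℚ_[p]) : H :=
  orderedProd h (pointCoord φ.toAlgHom)

omit hω hsat [IsTopologicalGroup H] in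
theorem ofPoint_injective : Function.Injective (ofPoint (p := p) h) := fun φ ψ hφψ => by
  rw [eq_point_pointCoord φ, eq_point_pointCoord ψ]
  exact congrArg point (hh.isHomeomorph.injective hφψ)

omit hω hsat [IsTopologicalGroup H] in
theorem ofPoint_surjective : Function.Surjective (ofPoint (p := p) h) := fun g =>
  ⟨point (hh.coord g), by rw [ofPoint, pointCoord_point, hh.orderedProd_coord]⟩

omit hω hsat [IsTopologicalGroup H] in
theorem ofPoint_eq {φ : TateAlgebra p (Fin d) →A[ℚ_[p]] ℚ_[p]} {g : H}
    (hφ : ∀ i, φ (X i) = hh.coord g i) : ofPoint h φ = g := by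
  have : pointCoord φ.toAlgHom = hh.coord g := funext fun i => Subtype.ext (hφ i)
  rw [ofPoint, this, hh.orderedProd_coord]

theorem ofPoint_mulPoint (φ ψ : TateAlgebra p (Fin d) →A[ℚ_[p]] ℚ_[p]) :
    ofPoint h (mulPoint hω hsat hh φ ψ) = ofPoint h φ * ofPoint h ψ := by
  refine hh.ofPoint_eq fun i => ?_
  have hpair : pair φ ψ =
      point (Fin.append (pointCoord φ.toAlgHom) (pointCoord ψ.toAlgHom)) :=
    continuousAlgHom_ext fun t => by
      induction t using Fin.addCases <;> simp [coe_pointCoord, -Fin.natAdd_eq_addNat]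
  rw [mulPoint, ContinuousAlgHom.comp_apply, comul, ofSeries_X, hpair,
    (exists_mulSeries hω hsat hh).choose_spec.2]
  rfl

theorem ofPoint_invPoint (φ : TateAlgebra p (Fin d) →A[ℚ_[p]] ℚ_[p]) :
    ofPoint h (invPoint hω hsat hh φ) = (ofPoint h φ)⁻¹ := by
  refine hh.ofPoint_eq fun i => ?_
  have hgather : gather (fun _ => φ) Fin.rev = point fun j => pointCoord φ.toAlgHom j.rev :=
    continuousAlgHom_ext fun t => by simp [coe_pointCoord]
  rw [invPoint, ContinuousAlgHom.comp_apply, antipode, ofSeries_X, hgather,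
    (exists_invSeries hω hsat hh).choose_spec.2]
  rfl

omit hsat in
theorem ofPoint_origin : ofPoint (p := p) h origin = 1 :=
  hh.ofPoint_eq fun i => by rw [origin_X, coord_one hω hh]; simp

section

variable {A : Type*} [NormedCommRing A] [NormedAlgebra ℚ_[p] A] [CompleteSpace A]
  [IsUltrametricDist A]

omit hω hsat hh in
theorem comp_origin {A' : Type*} [NormedCommRing A'] [NormedAlgebra ℚ_[p] A'] [CompleteSpace A']
    [IsUltrametricDist A'] (f : A →A[ℚ_[p]] A') :
    f.comp (origin : TateAlgebra p (Fin d) →A[ℚ_[p]] A) = origin :=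
  continuousAlgHom_ext fun t => by simp

/-- Associativity holds for the universal triple of points because it holds for all triples of
`ℚ_p`-points. -/
theorem mulPoint_assoc (x y z : TateAlgebra p (Fin d) →A[ℚ_[p]] A) :
    mulPoint hω hsat hh (mulPoint hω hsat hh x y) z =
      mulPoint hω hsat hh x (mulPoint hω hsat hh y z) := by
  obtain ⟨f, u, hu⟩ := exists_comp_eq ![x, y, z]
  obtain rfl : f.comp (u 0) = x := hu 0
  obtain rfl : f.comp (u 1) = y := hu 1
  obtain rfl : f.comp (u 2) = z := hu 2
  simp only [← comp_mulPoint]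
  congr 1
  refine continuousAlgHom_ext_of_points fun q => hh.ofPoint_injective ?_
  simp only [comp_mulPoint, ofPoint_mulPoint, mul_assoc]

theorem origin_mulPoint (x : TateAlgebra p (Fin d) →A[ℚ_[p]] A) :
    mulPoint hω hsat hh origin x = x := by
  obtain ⟨f, u, hu⟩ := exists_comp_eq ![x]
  obtain rfl : f.comp (u 0) = x := hu 0
  rw [← comp_origin f, ← comp_mulPoint]
  congr 1
  refine continuousAlgHom_ext_of_points fun q => hh.ofPoint_injective ?_
  rw [comp_mulPoint, comp_origin, ofPoint_mulPoint, ofPoint_origin hω hh, one_mul]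

theorem invPoint_mulPoint (x : TateAlgebra p (Fin d) →A[ℚ_[p]] A) :
    mulPoint hω hsat hh (invPoint hω hsat hh x) x = origin := by
  obtain ⟨f, u, hu⟩ := exists_comp_eq ![x]
  obtain rfl : f.comp (u 0) = x := hu 0
  rw [← comp_origin f, ← comp_invPoint, ← comp_mulPoint]
  congr 1
  refine continuousAlgHom_ext_of_points fun q => hh.ofPoint_injective ?_
  rw [comp_mulPoint, comp_origin, ofPoint_mulPoint, comp_invPoint, ofPoint_invPoint,
    ofPoint_origin hω hh, inv_mul_cancel]

/-- The group structure on the `A`-points of the closed ball. -/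
noncomputable abbrev groupPoints (A : Type*) [NormedCommRing A] [NormedAlgebra ℚ_[p] A]
    [CompleteSpace A] [IsUltrametricDist A] : Group (TateAlgebra p (Fin d) →A[ℚ_[p]] A) :=
  letI : Mul (TateAlgebra p (Fin d) →A[ℚ_[p]] A) := ⟨mulPoint hω hsat hh⟩
  letI : Inv (TateAlgebra p (Fin d) →A[ℚ_[p]] A) := ⟨invPoint hω hsat hh⟩
  letI : One (TateAlgebra p (Fin d) →A[ℚ_[p]] A) := ⟨origin⟩
  Group.ofLeftAxioms (mulPoint_assoc hω hsat hh) (origin_mulPoint hω hsat hh)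
    (invPoint_mulPoint hω hsat hh)

end

/-- The rigid analytic group attached to a saturated group with an ordered basis. -/
noncomputable def rigidGroup : RigidGroupStructure p (TateAlgebra p (Fin d)) where
  group A _ _ _ :=
    haveI := IsAffinoidAlgebra.complete p (A := A)
    haveI := IsAffinoidAlgebra.ultrametric p (A := A)
    groupPoints hω hsat hh A
  comp_mul A A' _ _ _ _ _ _ f x y :=
    haveI := IsAffinoidAlgebra.complete p (A := A)
    haveI := IsAffinoidAlgebra.ultrametric p (A := A)
    haveI := IsAffinoidAlgebra.complete p (A := A')
    haveI := IsAffinoidAlgebra.ultrametric p (A := A')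
    comp_mulPoint hω hsat hh f x y

end Laws

omit [IsTopologicalGroup H] in
/-- A rigid analytic group structure on the closed ball is determined by the group structure on its
`ℚ_p`-points: by naturality, it is determined by the product of the two projections in the points
with values in the Tate algebra of the product, to which the identity principle applies. -/
theorem rigidGroupStructure_ext (hh : ω.IsOrderedBasis h)
    {G G' : RigidGroupStructure p (TateAlgebra p (Fin d))}
    (hG : ∀ x y, ofPoint h ((G.group ℚ_[p]).mul x y) = ofPoint h x * ofPoint h y)
    (hG' : ∀ x y, ofPoint h ((G'.group ℚ_[p]).mul x y) = ofPoint h x * ofPoint h y) : G = G' := by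
  have key : ∀ (A : Type) [NormedCommRing A] [NormedAlgebra ℚ_[p] A] [IsAffinoidAlgebra p A]
      (x y : TateAlgebra p (Fin d) →A[ℚ_[p]] A), (G.group A).mul x y = (G'.group A).mul x y := by
    intro A _ _ _ x y
    have := IsAffinoidAlgebra.complete p (A := A)
    have := IsAffinoidAlgebra.ultrametric p (A := A)
    let i₁ : TateAlgebra p (Fin d) →A[ℚ_[p]] TateAlgebra p (Fin (d + d)) :=
      gather (fun _ => ContinuousAlgHom.id ℚ_[p] _) (Fin.castAdd d)
    let i₂ : TateAlgebra p (Fin d) →A[ℚ_[p]] TateAlgebra p (Fin (d + d)) :=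
      gather (fun _ => ContinuousAlgHom.id ℚ_[p] _) (Fin.natAdd d)
    have h₁ : (pair x y).comp i₁ = x := continuousAlgHom_ext fun t => by simp [i₁]
    have h₂ : (pair x y).comp i₂ = y := continuousAlgHom_ext fun t => by
      simp [i₂, -Fin.natAdd_eq_addNat]
    have huniv : (G.group _).mul i₁ i₂ = (G'.group _).mul i₁ i₂ :=
      continuousAlgHom_ext_of_points fun q => hh.ofPoint_injective (by
        rw [G.comp_mul, G'.comp_mul, hG, hG'])
    have e₁ := G.comp_mul _ _ (pair x y) i₁ i₂
    have e₂ := G'.comp_mul _ _ (pair x y) i₁ i₂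
    rw [h₁, h₂] at e₁ e₂
    rw [← e₁, ← e₂, huniv]
  obtain ⟨g, _⟩ := G
  obtain ⟨g', _⟩ := G'
  simp only [RigidGroupStructure.mk.injEq]
  funext A _ _ _
  exact Group.ext (funext fun x => funext fun y => key A x y)

end IsOrderedBasis

end PValuation

theorem mainTheorem5 (p : ℕ) [Fact p.Prime] {H : Type*} [Group H] [TopologicalSpace H]
    [IsTopologicalGroup H] (ω : PValuation p H) (hω : ω.DefinesTopology) (hsat : ω.IsSaturated)
    {d : ℕ} (h : Fin d → H) (hh : ω.IsOrderedBasis h) :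
    ∃! G : RigidGroupStructure p (TateAlgebra p (Fin d)),
      ∃ e : G.Points ≃* H, ∀ φ : TateAlgebra p (Fin d) →ₐ[ℚ_[p]] ℚ_[p],
        e (G.toPoints φ) = orderedProd h (fun i => TateAlgebra.pointCoord φ i) := by
  refine ⟨PValuation.IsOrderedBasis.rigidGroup hω hsat hh, ?_, ?_⟩
  · let e : (TateAlgebra p (Fin d) →ₐ[ℚ_[p]] ℚ_[p]) ≃ H :=
      (algHomEquivContinuousAlgHom p _).trans
        (Equiv.ofBijective _ ⟨hh.ofPoint_injective, hh.ofPoint_surjective⟩)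
    exact ⟨{ e with
      map_mul' := fun x y => PValuation.IsOrderedBasis.ofPoint_mulPoint hω hsat hh
        (algHomEquivContinuousAlgHom p _ x) (algHomEquivContinuousAlgHom p _ y) }, fun φ => rfl⟩
  · rintro G ⟨e, he⟩
    refine hh.rigidGroupStructure_ext (fun x y => ?_)
      (PValuation.IsOrderedBasis.ofPoint_mulPoint hω hsat hh)
    have hpt : ∀ x : TateAlgebra p (Fin d) →A[ℚ_[p]] ℚ_[p],
        e (G.toPoints x.toAlgHom) = PValuation.IsOrderedBasis.ofPoint h x := fun x => he _
    rw [← hpt, ← hpt, ← hpt, ← map_mul]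
    rfl
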